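/- Let $\gamma_0=\{(-1+i)x: 0\le x\le 27^{1/4}/\sqrt2\}\cup\{(-1-i)x: 0\le x\le 27^{1/4}/\sqrt2\}$ be the L-shaped arc in $\mathbb{C}$ consisting of two segments of length $27^{1/4}$ that meet at the origin at a right angle, and let $$\psi_0(w)=\Big(w-\frac1w\Big)\Big(\frac{w-1}{w+1}\Big)^{1/2}$$ (principal branch) be the conformal map of $|w|>1$ onto $\mathbb{C}\setminus\gamma_0$, extended continuously to $|w|=1$. For an integer $n\ge 1$ put, for $0\le k\le\lfloor n/2\rfloor$, $\theta_{n,k}=\frac{2k\pi}{n+1}$ if $n$ is even and $\theta_{n,k}=\frac{(2k+1)\pi}{n+1}$ if $n$ is odd, and put $\theta_{n,k}=-\theta_{n,2\lfloor n/2\rfloor+1-k}$ for $\lfloor n/2\rfloor<k\le n$. Let $z^*_{n,k}=\psi_0(e^{i\theta_{n,k}})$, $0\le k\le n$, be the corresponding Fejér points; they are pairwise distinct points of $\gamma_0$. Let $L_{\mathbf z^*_n}$ be their Lebesgue constant, i.e. the operator norm, for the sup norm on $C(\gamma_0)$, of the operator that maps $f\in C(\gamma_0)$ to the restriction to $\gamma_0$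 of the polynomial of degree at most $n$ that agrees with $f$ at $z^*_{n,0},\dots,z^*_{n,n}$. Then: 1. there is a constant $c_1>0$ such that $c_1\log^2(n)\le L_{\mathbf z^*_n}$ for all integers $n\ge1$; 2. $\displaystyle\limsup_{n\to\infty}\frac{L_{\mathbf z^*_n}}{\log^2(n)}=\infty$; 3. there are a constant $c_2>0$ and a strictly increasing sequence of positive integers $n_1<n_2<\cdots$ such that $L_{\mathbf z^*_{n_m}}\ge c_2\,n_m^{1/3}$ for all $m$. -/

import Mathlib

noncomputable section

namespace FejerLebesgue

open Complex Polynomial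

/-! ### Interpolation operators and Lebesgue constants -/

/-- The operator `A_z` on the Banach space `C(X)` (sup norm) of a compact set `X ⊆ ℂ`, which sends
`f` to (the restriction to `X` of) the unique polynomial of degree at most `n` that agrees with `f`
at the `n + 1` distinct points `z 0, …, z n` of `X`. -/
def interpolationOperator {X : Set ℂ} [CompactSpace X] {n : ℕ} (z : Fin (n + 1) → X)
    (_hz : Function.Injective z) : C(X, ℂ) →L[ℂ] C(X, ℂ) where
  toFun f := (Lagrange.interpolate Finset.univ (fun k => (z k : ℂ))
    (fun k => f (z k))).toContinuousMapOn X
  map_add' f g := by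
    ext x
    simp [Lagrange.interpolate_apply, eval_finsetSum, add_mul, Finset.sum_add_distrib]
  map_smul' c f := by
    ext x
    simp [Lagrange.interpolate_apply, eval_finsetSum, Finset.mul_sum, mul_assoc]
  cont := by
    have h : ∀ f : C(X, ℂ), (Lagrange.interpolate Finset.univ (fun k => (z k : ℂ))
        (fun k => f (z k))).toContinuousMapOn X =
        ∑ k, f (z k) •
          (Lagrange.basis Finset.univ (fun k => (z k : ℂ)) k).toContinuousMapOn X := by
      intro f
      ext x
      simp [Lagrange.interpolate_apply, eval_finsetSum]
    simp only [h]
    fun_prop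

/-- The Lebesgue constant `L_z`: the norm of the interpolation operator. -/
def lebesgueConstant {X : Set ℂ} [CompactSpace X] {n : ℕ} (z : Fin (n + 1) → X)
    (hz : Function.Injective z) : ℝ :=
  ‖interpolationOperator z hz‖

/-! ### The arc, its exterior map, and the Fejér points -/

/-- The L-shaped arc: two segments of length `27 ^ (1 / 4)` that meet at a right angle at `0`. -/
def gamma0 : Set ℂ :=
  (fun x : ℝ => (-1 + I) * (x : ℂ)) '' Set.Icc 0 ((27 : ℝ) ^ (1 / 4 : ℝ) / √2) ∪
  (fun x : ℝ => (-1 - I) * (x : ℂ)) '' Set.Icc 0 ((27 : ℝ) ^ (1 / 4 : ℝ) / √2)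

instance : CompactSpace gamma0 := by
  rw [← isCompact_iff_compactSpace]
  exact (isCompact_Icc.image (by fun_prop)).union (isCompact_Icc.image (by fun_prop))

/-- The exterior conformal map `ψ₀(w) = (w - 1/w) ((w - 1)/(w + 1))^{1/2}` (principal branch),
used for `1 ≤ |w|`; at `w = -1` the formula gives `0`, the value of the continuous extension. -/
def psi0 (w : ℂ) : ℂ :=
  (w - 1 / w) * ((w - 1) / (w + 1)) ^ (1 / 2 : ℂ)

/-- The angles `θ_{n,k}` for `2 * k ≤ n`, i.e. those in `[0, π)`. -/
def thetaUpper (n k : ℕ) : ℝ :=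
  if Even n then 2 * k * Real.pi / (n + 1) else (2 * k + 1) * Real.pi / (n + 1)

/-- The angles `θ_{n,k}`, `0 ≤ k ≤ n`. -/
def theta (n k : ℕ) : ℝ :=
  if k ≤ n / 2 then thetaUpper n k else -thetaUpper n (2 * (n / 2) + 1 - k)

/-- The Fejér points `z*_{n,k} = ψ₀(e^{iθ_{n,k}})` as complex numbers. -/
def fejerValue (n k : ℕ) : ℂ :=
  psi0 (exp (theta n k * I))

/-! ### The Fejér points lie on the arc -/

/-- The integer `a` with `θ_{n,k} = a π / (n + 1)`. -/
def thetaNum (n k : ℕ) : ℤ :=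
  if k ≤ n / 2 then (if Even n then 2 * k else 2 * k + 1)
  else -(if Even n then 2 * (2 * (n / 2) + 1 - k : ℤ) else 2 * (2 * (n / 2) + 1 - k : ℤ) + 1)

theorem theta_eq {n k : ℕ} (hk : k ≤ n) : theta n k = thetaNum n k * Real.pi / (n + 1) := by
  unfold theta thetaNum thetaUpper
  have h : k ≤ 2 * (n / 2) + 1 := by omega
  have h2 : ((n / 2 : ℕ) : ℝ) = ((n / 2 : ℤ) : ℝ) := by exact_mod_cast rfl
  split_ifs <;> push_cast [Nat.cast_sub h, ← h2] <;> ring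

theorem thetaNum_lt {n k : ℕ} (hk : k ≤ n) : thetaNum n k < n + 1 := by
  unfold thetaNum
  simp only [Nat.even_iff]
  split_ifs <;> omega

theorem neg_lt_thetaNum {n k : ℕ} (hk : k ≤ n) : -(n + 1 : ℤ) < thetaNum n k := by
  unfold thetaNum
  simp only [Nat.even_iff]
  split_ifs <;> omega

theorem theta_mem {n k : ℕ} (hk : k ≤ n) : -Real.pi < theta n k ∧ theta n k < Real.pi := by
  have h1 : (thetaNum n k : ℝ) < n + 1 := by exact_mod_cast thetaNum_lt hk
  have h2 : -(n + 1 : ℝ) < thetaNum n k := by exact_mod_cast neg_lt_thetaNum hk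
  have hn : (0 : ℝ) < n + 1 := by positivity
  have hp := Real.pi_pos
  rw [theta_eq hk]
  constructor
  · rw [lt_div_iff₀ hn]; nlinarith
  · rw [div_lt_iff₀ hn]; nlinarith

/-- The square of `ψ₀`, without roots. -/
theorem psi0_sq {w : ℂ} (h0 : w ≠ 0) (h1 : w + 1 ≠ 0) :
    psi0 w ^ 2 = (w - 1) ^ 3 * (w + 1) / w ^ 2 := by
  unfold psi0
  have h : (((w - 1) / (w + 1)) ^ (1 / 2 : ℂ)) ^ 2 = (w - 1) / (w + 1) := by
    rw [← cpow_nat_mul]; norm_num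
  rw [mul_pow, h]
  field_simp
  ring

theorem psi0_exp {t : ℝ} (h1 : -Real.pi < t) (h2 : t < Real.pi) :
    psi0 (exp (t * I)) = 2 * Real.sin t * I * (Real.tan (t / 2) * I) ^ (1 / 2 : ℂ) := by
  have hc : (0 : ℝ) < Real.cos (t / 2) := Real.cos_pos_of_mem_Ioo ⟨by linarith, by linarith⟩
  have hc' : (Real.cos (t / 2) : ℂ) ≠ 0 := by exact_mod_cast hc.ne'
  have e1 : exp (t * I) = (Real.cos (t / 2) + Real.sin (t / 2) * I) ^ 2 := by
    rw [ofReal_cos, ofReal_sin, ← exp_mul_I, ← exp_nat_mul]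
    congr 1; push_cast; ring
  have e2 : exp (t * I) - 1 / exp (t * I) = 2 * Real.sin t * I := by
    rw [one_div, ← exp_neg, ofReal_sin, Complex.sin, ← neg_mul]
    linear_combination (exp (↑t * I) - exp (-↑t * I)) * I_sq
  have e3 : (exp (t * I) - 1) / (exp (t * I) + 1) = Real.tan (t / 2) * I := by
    have hs : (Real.sin (t / 2) : ℂ) ^ 2 + (Real.cos (t / 2) : ℂ) ^ 2 = 1 := by
      exact_mod_cast Real.sin_sq_add_cos_sq (t / 2)
    have hne : (Real.cos (t / 2) + Real.sin (t / 2) * I : ℂ) ≠ 0 := by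
      rw [ofReal_cos, ofReal_sin, ← exp_mul_I]; exact exp_ne_zero _
    have ha : exp (t * I) + 1 =
        2 * Real.cos (t / 2) * (Real.cos (t / 2) + Real.sin (t / 2) * I) := by
      rw [e1]; linear_combination (Real.sin (t / 2) : ℂ) ^ 2 * I_sq - hs
    have hb : exp (t * I) - 1 =
        2 * Real.sin (t / 2) * I * (Real.cos (t / 2) + Real.sin (t / 2) * I) := by
      rw [e1]; linear_combination -(Real.sin (t / 2) : ℂ) ^ 2 * I_sq + hs
    rw [ha, hb, Real.tan_eq_sin_div_cos]
    push_cast at hne hc' ⊢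
    field_simp
  unfold psi0
  rw [e2, e3]


theorem exists_dyadic_valuation :
    ∃ V : ValuationSubring ℂ, V.valuation (2 : ℂ) < 1 := by
  let A : Subring ℂ := (Int.castRingHom ℂ).range
  let two : A := ⟨2, 2, by simp⟩
  have hI : Ideal.span {two} ≠ ⊤ := by
    rw [Ne, Ideal.eq_top_iff_one, Ideal.mem_span_singleton']
    rintro ⟨⟨_, m, rfl⟩, hm⟩
    have h : ((m * 2 : ℤ) : ℂ) = ((1 : ℤ) : ℂ) := by simpa [two] using congrArg Subtype.val hm
    have := Int.cast_injective h
    omega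
  obtain ⟨V, -, hV⟩ := Ideal.image_subset_nonunits_valuationSubring _ hI
  exact ⟨V, V.mem_nonunits_iff.mp (hV ⟨two, Ideal.mem_span_singleton_self _, rfl⟩)⟩

theorem valuation_rootOfUnity (V : ValuationSubring ℂ) {z : ℂ} {N : ℕ} (hN : N ≠ 0)
    (hz : z ^ N = 1) : V.valuation z = 1 := by
  have h : V.valuation z ^ N = 1 := by rw [← map_pow, hz, map_one]
  exact (pow_eq_one_iff.mp h).resolve_right hN

theorem valuation_one_sub_pow_le (V : ValuationSubring ℂ) {z : ℂ} (hz : V.valuation z ≤ 1)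
    (m : ℕ) : V.valuation (1 - z ^ m) ≤ V.valuation (1 - z) := by
  have h : 1 - z ^ m = (1 - z) * ∑ i ∈ Finset.range m, z ^ i := by
    rw [mul_comm]; linear_combination geom_sum_mul z m
  rw [h, map_mul]
  refine mul_le_of_le_one_right' ?_
  refine V.valuation.map_sum_le fun i _ => ?_
  rw [map_pow]
  exact pow_le_one' hz i

theorem valuation_odd (V : ValuationSubring ℂ) (h2 : V.valuation (2 : ℂ) < 1) (m : ℕ) :
    V.valuation (2 * m + 1 : ℂ) = 1 := by
  have h : V.valuation (2 * m : ℂ) < 1 := by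
    rw [map_mul]
    refine lt_of_le_of_lt (mul_le_of_le_one_right' ?_) h2
    exact (V.valuation_le_one_iff _).mpr (natCast_mem _ _)
  rw [add_comm, V.valuation.map_one_add_of_lt h]

/-- The key estimate: a root of unity other than `±1` is not too close to `1` at a place above
`2`. -/
theorem valuation_two_le (V : ValuationSubring ℂ) (h2 : V.valuation (2 : ℂ) < 1) {z : ℂ} {N : ℕ}
    (hN : N ≠ 0) (hz : z ^ N = 1) (h : z ^ 2 ≠ 1) :
    V.valuation 2 ≤ V.valuation (1 - z) ^ 2 := by
  have hv := valuation_rootOfUnity V hN hz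
  set M := orderOf z with hM
  have hMpos : 0 < M := orderOf_pos_iff.mpr (isOfFinOrder_iff_pow_eq_one.mpr ⟨N, by omega, hz⟩)
  by_cases h4 : 4 ∣ M
  · obtain ⟨d, hd⟩ := h4
    have hi : (z ^ d) ^ 2 = -1 := by
      have h1 : ((z ^ d) ^ 2) ^ 2 = 1 := by
        rw [← pow_mul, ← pow_mul, show d * (2 * 2) = M by omega]; exact pow_orderOf_eq_one z
      refine (sq_eq_one_iff.mp h1).resolve_left fun h' => ?_
      rw [← pow_mul] at h'
      have := Nat.le_of_dvd (by omega) (orderOf_dvd_of_pow_eq_one h')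
      omega
    have hle := valuation_one_sub_pow_le V hv.le d
    have : V.valuation (1 - z ^ d) ^ 2 = V.valuation 2 := by
      rw [← map_pow, show (1 - z ^ d) ^ 2 = -2 * z ^ d by linear_combination hi, map_mul,
        map_pow, hv, Valuation.map_neg]
      simp
    rw [← this]
    exact pow_le_pow_left' hle 2
  · -- here `z ^ 2` has odd order at least `3`
    obtain ⟨m, hm⟩ : ∃ m : ℕ, (z ^ 2) ^ (2 * m + 1) = 1 := by
      rcases Nat.even_or_odd' M with ⟨c, hc | hc⟩
      · refine ⟨c / 2, ?_⟩
        rw [← pow_mul, show 2 * (2 * (c / 2) + 1) = M by omega]; exact pow_orderOf_eq_one z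
      · refine ⟨c, ?_⟩
        rw [← hc, ← pow_mul, mul_comm, pow_mul, pow_orderOf_eq_one, one_pow]
    have hle := valuation_one_sub_pow_le V hv.le 2
    have h1 : 1 ≤ V.valuation (1 - z ^ 2) := by
      by_contra hlt
      rw [not_le] at hlt
      have hs : ∑ i ∈ Finset.range (2 * m + 1), (z ^ 2) ^ i = 0 := by
        have := geom_sum_mul (z ^ 2) (2 * m + 1)
        rw [hm, sub_self] at this
        exact (mul_eq_zero.mp this).resolve_right (sub_ne_zero.mpr h)
      have hs' : ∑ i ∈ Finset.range (2 * m + 1), (1 - (z ^ 2) ^ i) = (2 * m + 1 : ℂ) := by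
        rw [Finset.sum_sub_distrib, hs]; simp
      have := valuation_odd V h2 m
      rw [← hs'] at this
      refine absurd this (ne_of_lt ?_)
      refine V.valuation.map_sum_lt one_ne_zero fun i _ => ?_
      exact lt_of_le_of_lt (valuation_one_sub_pow_le V (by rw [map_pow, hv, one_pow]) i) hlt
    exact h2.le.trans (one_le_pow_of_one_le' (h1.trans hle) 2)

/-- If two `N`-th roots of `1` (`N` odd) or of `-1` (`N` even) have the same value of
`(w - 1)^3 (w + 1) / w^2`, then they are equal. -/
theorem eq_of_psi0_sq_eq {N : ℕ} (hN : N ≠ 0) {e u v : ℂ}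
    (he : Odd N ∧ e = 1 ∨ Even N ∧ e = -1) (hu : u ^ N = e) (hv : v ^ N = e)
    (huv : (u - 1) ^ 3 * (u + 1) / u ^ 2 = (v - 1) ^ 3 * (v + 1) / v ^ 2) : u = v := by
  have he0 : e ≠ 0 := by rcases he with h | h <;> rw [h.2] <;> norm_num
  have hu0 : u ≠ 0 := by rintro rfl; rw [zero_pow hN] at hu; exact he0 hu.symm
  have hv0 : v ≠ 0 := by rintro rfl; rw [zero_pow hN] at hv; exact he0 hv.symm
  by_contra hne
  obtain ⟨V, h2⟩ := exists_dyadic_valuation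
  have he2 : e * e = 1 := by rcases he with h | h <;> rw [h.2] <;> norm_num
  obtain ⟨P, hP⟩ : ∃ P, P = u * v := ⟨_, rfl⟩
  obtain ⟨Q, hQ⟩ : ∃ Q, Q = u / v := ⟨_, rfl⟩
  have hPN : P ^ N = 1 := by rw [hP, mul_pow, hu, hv, he2]
  have hQN : Q ^ N = 1 := by rw [hQ, div_pow, hu, hv, div_self he0]
  have hPQ : P * Q = u ^ 2 := by rw [hP, hQ]; field_simp
  have hP0 : P ≠ 0 := by rw [hP]; exact mul_ne_zero hu0 hv0
  have hQ1 : Q ≠ 1 := by rw [hQ]; intro h; exact hne ((div_eq_one_iff_eq hv0).mp h)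
  -- the relation between `P` and `Q`
  have hrel : v * (1 + Q) * (1 + P ^ 2) = 2 * P * (1 + P) := by
    have h1 : (u - v) * (v * (1 + Q) * (1 + P ^ 2) - 2 * P * (1 + P)) = 0 := by
      rw [div_eq_div_iff (pow_ne_zero 2 hu0) (pow_ne_zero 2 hv0)] at huv
      have : v * (1 + Q) = u + v := by rw [hQ]; field_simp; ring
      rw [this, hP]
      linear_combination huv
    exact sub_eq_zero.mp ((mul_eq_zero.mp h1).resolve_left (sub_ne_zero.mpr hne))
  -- parity
  have hhalf : ∀ K, N = 2 * K → (P * Q) ^ K = -1 := by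
    intro K hK
    rw [hPQ, ← pow_mul, ← hK, hu]
    rcases he with h | h
    · exact absurd h.1 (by rw [hK]; simp)
    · exact h.2
  have hodd : ∀ z : ℂ, z ^ N = 1 → z = -1 → Even N := by
    rintro z hz rfl
    by_contra h
    rw [Nat.not_even_iff_odd] at h
    rw [h.neg_one_pow] at hz
    norm_num at hz
  have hQm : Q ≠ -1 := by
    intro h
    obtain ⟨K, hK⟩ := hodd Q hQN h
    have hPm : P = -1 := by
      rw [h] at hrel
      have : 2 * P * (1 + P) = 0 := by rw [← hrel]; ring
      have := (mul_eq_zero.mp this).resolve_left (mul_ne_zero two_ne_zero hP0)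
      linear_combination this
    have := hhalf K (by omega)
    rw [h, hPm] at this
    norm_num at this
  have hv1 : v ≠ 0 := hv0
  have hQ' : 1 + Q ≠ 0 := fun h => hQm (by linear_combination h)
  have hPm : P ≠ -1 := by
    intro h
    rw [h] at hrel
    have : v * (1 + Q) = 0 := by linear_combination hrel / 2
    exact (mul_ne_zero hv0 hQ') this
  have hPi : P ^ 2 ≠ -1 := by
    intro h
    rw [h] at hrel
    have : 2 * P * (1 + P) = 0 := by rw [← hrel]; ring
    have := (mul_eq_zero.mp this).resolve_left (mul_ne_zero two_ne_zero hP0)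
    exact hPm (by linear_combination this)
  have hv2N : v ^ (2 * N) = 1 := by rw [mul_comm, pow_mul, hv, sq, he2]
  have hN2 : 2 * N ≠ 0 := by omega
  have vv := valuation_rootOfUnity V hN2 hv2N
  have vP := valuation_rootOfUnity V hN hPN
  have v2pos : 0 < V.valuation (2 : ℂ) := V.valuation.pos_iff.mpr two_ne_zero
  have vrel : V.valuation (1 + Q) * V.valuation (1 + P ^ 2) =
      V.valuation 2 * V.valuation (1 + P) := by
    have := congrArg V.valuation hrel
    simpa only [map_mul, vv, vP, one_mul, mul_one] using this
  have vQ : V.valuation 2 ≤ V.valuation (1 + Q) ^ 2 := by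
    have := valuation_two_le V h2 (z := -Q) hN2
      (by rw [pow_mul, neg_sq, ← pow_mul, mul_comm, pow_mul, hQN, one_pow])
      (by rw [neg_sq]; intro h; exact (sq_eq_one_iff.mp h).elim hQ1 hQm)
    simpa using this
  have hP1 : P ≠ 1 := by
    intro h
    rw [h, one_pow, show (1 : ℂ) + 1 = 2 by norm_num] at vrel
    rw [mul_right_cancel₀ v2pos.ne' vrel] at vQ
    exact absurd vQ (not_le.mpr (pow_lt_self_of_lt_one₀ v2pos h2 one_lt_two))
  have vP2 : V.valuation 2 ≤ V.valuation (1 + P ^ 2) ^ 2 := by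
    have := valuation_two_le V h2 (z := -P ^ 2) hN2
      (by rw [pow_mul, neg_sq, ← pow_mul, ← pow_mul, show 2 * (2 * N) = N * 4 by ring,
        pow_mul, hPN, one_pow])
      (by
        rw [neg_sq]; intro h
        rcases sq_eq_one_iff.mp h with h | h
        · exact (sq_eq_one_iff.mp h).elim hP1 hPm
        · exact hPi h)
    simpa using this
  have hb : V.valuation (1 + P ^ 2) ^ 2 ≤ V.valuation 2 * V.valuation (1 + P) ^ 2 := by
    have h3 : V.valuation 2 * V.valuation (1 + P ^ 2) ^ 2 ≤
        V.valuation 2 * (V.valuation 2 * V.valuation (1 + P) ^ 2) := by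
      calc _ ≤ V.valuation (1 + Q) ^ 2 * V.valuation (1 + P ^ 2) ^ 2 := by gcongr
        _ = _ := by rw [← mul_pow, vrel, mul_pow, sq, mul_assoc]
    exact (mul_le_mul_iff_right₀ v2pos).mp h3
  have hc : V.valuation (1 + P) < 1 := by
    by_contra hcon
    have hP' : V.valuation (1 + P) ≤ 1 :=
      (V.valuation.map_add _ _).trans (by simp [vP])
    have h4 : V.valuation (1 + P ^ 2) < 1 := by
      by_contra h5
      have h6 := (one_le_pow_of_one_le' (not_lt.mp h5) 2).trans
        (hb.trans (mul_le_of_le_one_right' (pow_le_one' hP' 2)))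
      exact absurd h6 (not_le.mpr h2)
    have h7 : V.valuation (1 + P) ^ 2 < 1 := by
      rw [← map_pow, show (1 + P) ^ 2 = (1 + P ^ 2) + 2 * P by ring]
      exact V.valuation.map_add_lt h4 (by rw [map_mul, vP, mul_one]; exact h2)
    exact absurd h7 (not_lt.mpr (one_le_pow_of_one_le' (not_lt.mp hcon) 2))
  have h8 : V.valuation 2 * V.valuation (1 + P) ^ 2 < V.valuation 2 * 1 :=
    (mul_lt_mul_iff_right₀ v2pos).mpr (pow_lt_one₀ zero_le hc two_ne_zero)
  rw [mul_one] at h8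
  exact absurd (vP2.trans hb) (not_le.mpr h8)

theorem thetaNum_injOn {n j k : ℕ} (hj : j ≤ n) (hk : k ≤ n) (h : thetaNum n j = thetaNum n k) :
    j = k := by
  unfold thetaNum at h
  simp only [Nat.even_iff] at h
  split_ifs at h <;> omega

theorem exp_theta_injOn {n j k : ℕ} (hj : j ≤ n) (hk : k ≤ n)
    (h : exp (theta n j * I) = exp (theta n k * I)) : j = k := by
  have h1 := theta_mem hj
  have h2 := theta_mem hk
  have h3 := exp_inj_of_neg_pi_lt_of_le_pi (by simpa using h1.1) (by simpa using h1.2.le)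
    (by simpa using h2.1) (by simpa using h2.2.le) h
  have h4 : theta n j = theta n k := by exact_mod_cast mul_right_cancel₀ I_ne_zero h3
  rw [theta_eq hj, theta_eq hk, div_left_inj' (by positivity),
    mul_left_inj' Real.pi_ne_zero] at h4
  exact thetaNum_injOn hj hk (by exact_mod_cast h4)

theorem exp_theta_pow {n k : ℕ} (hk : k ≤ n) :
    exp (theta n k * I) ^ (n + 1) = if Even n then 1 else -1 := by
  obtain ⟨a, ha⟩ : ∃ a : ℤ, thetaNum n k = if Even n then 2 * a else 2 * a + 1 := by
    unfold thetaNum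
    simp only [Nat.even_iff]
    split_ifs with h1 h2 h2
    · exact ⟨k, rfl⟩
    · exact ⟨k, rfl⟩
    · exact ⟨-(2 * (n / 2) + 1 - k), by ring⟩
    · exact ⟨-(2 * (n / 2) + 1 - k) - 1, by ring⟩
  have hn : (n + 1 : ℂ) ≠ 0 := by exact_mod_cast n.succ_ne_zero
  rw [← exp_nat_mul, theta_eq hk, ha]
  split_ifs
  · rw [exp_eq_one_iff]
    exact ⟨a, by push_cast; field_simp⟩
  · rw [← exp_pi_mul_I, exp_eq_exp_iff_exists_int]
    exact ⟨a, by push_cast; field_simp; ring⟩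

theorem fejerValue_injOn {n j k : ℕ} (hj : j ≤ n) (hk : k ≤ n)
    (h : fejerValue n j = fejerValue n k) : j = k := by
  have hne : ∀ {i : ℕ}, i ≤ n → exp (theta n i * I) + 1 ≠ 0 := by
    intro i hi h0
    have hi' := theta_mem hi
    have h1 : exp (theta n i * I) = exp (Real.pi * I) := by
      rw [exp_pi_mul_I]; linear_combination h0
    have hp := Real.pi_pos
    have h3 := exp_inj_of_neg_pi_lt_of_le_pi (by simpa using hi'.1) (by simpa using hi'.2.le)
      (by simp; linarith) (by simp) h1
    have h4 : theta n i = Real.pi := by exact_mod_cast mul_right_cancel₀ I_ne_zero h3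
    linarith [hi'.2]
  have hsq := congrArg (· ^ 2) h
  simp only [fejerValue] at hsq
  rw [psi0_sq (exp_ne_zero _) (hne hj), psi0_sq (exp_ne_zero _) (hne hk)] at hsq
  refine exp_theta_injOn hj hk (eq_of_psi0_sq_eq n.succ_ne_zero ?_ (exp_theta_pow hj)
    (exp_theta_pow hk) hsq)
  by_cases hn : Even n
  · exact Or.inl ⟨hn.add_one, if_pos hn⟩
  · exact Or.inr ⟨(Nat.not_even_iff_odd.mp hn).add_one, if_neg hn⟩

theorem mul_I_cpow_half {x : ℝ} (hx : 0 ≤ x) :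
    ((x : ℂ) * I) ^ (1 / 2 : ℂ) = √(x / 2) * (1 + I) ∧
    (((-x : ℝ) : ℂ) * I) ^ (1 / 2 : ℂ) = √(x / 2) * (1 - I) := by
  rcases hx.eq_or_lt with rfl | hx
  · simp
  have hs : (√(x / 2) : ℂ) ^ 2 = x / 2 := by
    exact_mod_cast Real.sq_sqrt (by positivity : (0 : ℝ) ≤ x / 2)
  have hpos : 0 < √(x / 2) := Real.sqrt_pos.mpr (by positivity)
  rw [one_div]
  constructor
  · rw [show (x : ℂ) * I = (√(x / 2) * (1 + I)) ^ 2 by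
      linear_combination (-2 * I) * hs - (√(x / 2) : ℂ) ^ 2 * I_sq]
    exact sq_cpow_two_inv (by simpa using hpos)
  · rw [show ((-x : ℝ) : ℂ) * I = (√(x / 2) * (1 - I)) ^ 2 by
      push_cast
      linear_combination (2 * I) * hs - (√(x / 2) : ℂ) ^ 2 * I_sq]
    exact sq_cpow_two_inv (by simpa using hpos)

theorem radius_mem {t : ℝ} (h1 : 0 ≤ t) (h2 : t < Real.pi) :
    2 * Real.sin t * √(Real.tan (t / 2) / 2) ∈
      Set.Icc 0 ((27 : ℝ) ^ (1 / 4 : ℝ) / √2) := by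
  have hc : 0 < Real.cos (t / 2) := Real.cos_pos_of_mem_Ioo ⟨by linarith, by linarith⟩
  have hs : 0 ≤ Real.sin (t / 2) :=
    Real.sin_nonneg_of_nonneg_of_le_pi (by linarith) (by linarith)
  have hst : 0 ≤ Real.sin t := Real.sin_nonneg_of_nonneg_of_le_pi h1 h2.le
  have hsc := Real.sin_sq_add_cos_sq (t / 2)
  have hdouble : Real.sin t = 2 * Real.sin (t / 2) * Real.cos (t / 2) := by
    rw [← Real.sin_two_mul]; congr 1; ring
  refine ⟨by positivity, ?_⟩
  refine le_of_pow_le_pow_left₀ (n := 4) (by norm_num) (by positivity) ?_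
  have e1 : ((27 : ℝ) ^ (1 / 4 : ℝ) / √2) ^ 4 = 27 / 4 := by
    rw [div_pow, ← Real.rpow_natCast, ← Real.rpow_mul (by norm_num),
      show (√2 : ℝ) ^ 4 = (√2 ^ 2) ^ 2 by ring, Real.sq_sqrt (by norm_num)]
    norm_num
  have e2 : (2 * Real.sin t * √(Real.tan (t / 2) / 2)) ^ 4 =
      64 * (Real.sin (t / 2) ^ 2) ^ 3 * Real.cos (t / 2) ^ 2 := by
    have : √(Real.tan (t / 2) / 2) ^ 2 = Real.tan (t / 2) / 2 := by
      refine Real.sq_sqrt ?_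
      rw [Real.tan_eq_sin_div_cos]; positivity
    rw [mul_pow, show √(Real.tan (t / 2) / 2) ^ 4 = (√(Real.tan (t / 2) / 2) ^ 2) ^ 2 by ring,
      this, hdouble, Real.tan_eq_sin_div_cos]
    field_simp
    ring
  rw [e1, e2, show Real.cos (t / 2) ^ 2 = 1 - Real.sin (t / 2) ^ 2 by linarith]
  set y := Real.sin (t / 2) ^ 2
  nlinarith [mul_nonneg (sq_nonneg (4 * y - 3)) (by nlinarith [sq_nonneg (2 * y + 1)] :
    (0 : ℝ) ≤ 4 * y ^ 2 + 2 * y + 3 / 4)]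

theorem psi0_exp_mem {t : ℝ} (h1 : -Real.pi < t) (h2 : t < Real.pi) :
    psi0 (exp (t * I)) ∈ gamma0 := by
  rw [psi0_exp h1 h2]
  rcases le_total 0 t with h | h
  · left
    have hx : 0 ≤ Real.tan (t / 2) :=
      Real.tan_nonneg_of_nonneg_of_le_pi_div_two (by linarith) (by linarith)
    refine ⟨_, radius_mem h h2, ?_⟩
    rw [(mul_I_cpow_half hx).1]
    push_cast
    linear_combination (-2 * Complex.sin t * √(Real.tan (t / 2) / 2)) * I_sq
  · right
    have hx : 0 ≤ Real.tan (-t / 2) :=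
      Real.tan_nonneg_of_nonneg_of_le_pi_div_two (by linarith) (by linarith)
    have hx' : Real.tan (t / 2) = -Real.tan (-t / 2) := by rw [← Real.tan_neg]; congr 1; ring
    refine ⟨_, radius_mem (t := -t) (by linarith) (by linarith), ?_⟩
    rw [hx', (mul_I_cpow_half hx).2]
    simp only [Real.sin_neg, ofReal_neg, ofReal_mul, ofReal_ofNat]
    linear_combination (2 * (Real.sin t : ℂ) * √(Real.tan (-t / 2) / 2)) * I_sq

/-! ### The family of Fejér points on the arc -/

/-- The Fejér points `z*_{n,k}`, `k = 0, …, n`, as points of the arc. -/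
def fejerPoint (n : ℕ) (k : Fin (n + 1)) : gamma0 :=
  ⟨fejerValue n k, psi0_exp_mem (theta_mem (Nat.lt_succ_iff.mp k.2)).1
    (theta_mem (Nat.lt_succ_iff.mp k.2)).2⟩

/-- The Fejér points are pairwise distinct. -/
theorem fejerPoint_injective (n : ℕ) : Function.Injective (fejerPoint n) := fun j k h =>
  Fin.ext (fejerValue_injOn (Nat.lt_succ_iff.mp j.2) (Nat.lt_succ_iff.mp k.2)
    (congrArg Subtype.val h))

end FejerLebesgue

end

namespace FejerLebesgue

open Complex Polynomial

/-! Write `N = n + 1`. The preimages of the Fejér points are all the roots of `w ^ N = ε` with `ε =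
±1`, and `ψ₀(w)² = (w - 1)³(w + 1)/w²` is rational. For `z` on the upper segment the quartic `ψ₀(s)²
= z²` has two roots `w = e^{i(β+d)}`, `w' = e^{i(β-d)}` on the circle, both mapped to `z`, one root
`u` outside, with `ψ₀(u) = -z`, and one root `v` inside. Multiplying over the nodes, `∏|z - z_j| ·
∏|z + z_j|` is the product of `|s ^ N - ε|` over these four roots
(`prod_norm_sub_mul_prod_norm_add`). The second factor is comparable to `|u| ^ N`: its logarithm is
a quadrature sum for a unimodal function whose mean is `log |u|` by Jensen's formula
(`abs_sum_log_norm_add_sub_le`). The factors of `u` and `v` cancel up to constants, so `∏|z - z_j|`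
is comparable to `|w ^ N - ε||w' ^ N - ε|`.

If `z = z_k` is itself a node, `w ^ N = ε`, and the same computation bounds the derivative of the
node polynomial at `z_k` by a constant times `N |sin(Nβ(d))| / d`. It is small when the other
preimage `w'` is nearly a root of `ε` as well, that is, when two images nearly coincide on the two
sides of the arc. Here `β(d)` equals `2π/3` minus a quantity of order `d²`; `d = 0` is the tip of
the segment, near which `|x - z_k|` is `O(d²)`. Evaluating at the point with `d₀ = π/(2N)`, where
the node polynomial is not small, gives `|ℓ_k| ≥ κ / (N d |sin(Nβ(d))|)` (`exists_le_specialBasis`).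

If `N` is an odd multiple of `3`, the tip is a node and `Nβ(0)` is a multiple of `π`. The next node
has `d` of order `1/N` and `|sin(Nβ(d))| = O(1/N)`, so one term already grows linearly
(`exists_linear_lower_bound`). This is more than the power `1/3` and the unbounded quotient require.

For general `n`, let `D_m` be the successive solutions of `Nβ(D) ∈ πℤ`, so that `D_m²` is of order
`m/N`. For the `i`-th node after `D_m` the denominator `N d |sin(Nβ(d))|` is `O(m i)`. The sum of
`1/(m i)` over `m ≤ p²`, `i ≤ p` with `p` of order `N^{1/4}` is at least a multiple of `log² n`
(`mul_harmonic_le_lebesgueConstant`). -/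

/-! ### Lebesgue function and fundamental polynomials -/

/-- The Lebesgue constant dominates the Lebesgue function at every point. -/
theorem sum_norm_eval_basis_le_lebesgueConstant {X : Set ℂ} [CompactSpace X] {n : ℕ}
    (z : Fin (n + 1) → X) (hz : Function.Injective z) (x : X) :
    ∑ k, ‖(Lagrange.basis Finset.univ (fun k => (z k : ℂ)) k).eval (x : ℂ)‖ ≤
      lebesgueConstant z hz := by
  set l : Fin (n + 1) → ℂ :=
    fun k => (Lagrange.basis Finset.univ (fun k => (z k : ℂ)) k).eval (x : ℂ) with hl
  have hs : ∀ k, ∃ s : ℂ, ‖s‖ ≤ 1 ∧ s * l k = (‖l k‖ : ℂ) := by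
    intro k
    by_cases h : l k = 0
    · exact ⟨0, by simp, by simp [h]⟩
    · refine ⟨(‖l k‖ : ℂ) / l k, ?_, by field_simp⟩
      rw [norm_div, norm_real, norm_norm, div_self (norm_ne_zero_iff.mpr h)]
  choose s hs1 hs2 using hs
  -- Extending the unimodular data inside the closed unit disc, rather than in `ℂ`, keeps the sup
  -- norm of the extension at most `1`.
  have : TietzeExtension (Metric.closedBall (0 : ℂ) 1) :=
    Metric.instTietzeExtensionClosedBall ℂ 0 one_pos
  have he : Topology.IsClosedEmbedding z :=
    (continuous_of_discreteTopology).isClosedEmbedding hz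
  obtain ⟨g, hg⟩ := ContinuousMap.exists_extension' (Y := Metric.closedBall (0 : ℂ) 1) he
    ⟨fun k => ⟨s k, by simpa using hs1 k⟩, continuous_of_discreteTopology⟩
  let f : C(X, ℂ) := ⟨fun y => (g y : ℂ), by fun_prop⟩
  have hf : ‖f‖ ≤ 1 := by
    rw [ContinuousMap.norm_le _ zero_le_one]
    intro y
    exact mem_closedBall_zero_iff.mp (g y).2
  have hfk : ∀ k, f (z k) = s k := fun k => by
    have := congrFun hg k
    exact congrArg Subtype.val this
  have h1 : interpolationOperator z hz f x = ((∑ k, ‖l k‖ : ℝ) : ℂ) := by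
    change (Lagrange.interpolate Finset.univ (fun k => (z k : ℂ)) (fun k => f (z k))).eval
      (x : ℂ) = _
    rw [Lagrange.interpolate_apply, eval_finsetSum]
    push_cast
    refine Finset.sum_congr rfl fun k _ => ?_
    rw [eval_mul, eval_C, hfk, ← hs2]
  have h2 : ‖interpolationOperator z hz f x‖ ≤ lebesgueConstant z hz :=
    calc _ ≤ ‖interpolationOperator z hz f‖ := ContinuousMap.norm_coe_le_norm _ _
      _ ≤ ‖interpolationOperator z hz‖ * ‖f‖ := ContinuousLinearMap.le_opNorm _ _
      _ ≤ ‖interpolationOperator z hz‖ * 1 := by gcongr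
      _ = _ := mul_one _
  rw [h1, norm_real, Real.norm_of_nonneg (Finset.sum_nonneg fun _ _ => norm_nonneg _)] at h2
  exact h2

theorem norm_eval_basis_mul {n : ℕ} (v : Fin (n + 1) → ℂ) (hv : Function.Injective v)
    (k : Fin (n + 1)) (x : ℂ) :
    ‖(Lagrange.basis Finset.univ v k).eval x‖ * (‖x - v k‖ *
      ∏ j ∈ Finset.univ.erase k, ‖v k - v j‖) = ∏ j, ‖x - v j‖ := by
  have h : (Lagrange.basis Finset.univ v k).eval x =
      ∏ j ∈ Finset.univ.erase k, (x - v j) / (v k - v j) := by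
    rw [Lagrange.basis, eval_prod]
    refine Finset.prod_congr rfl fun j _ => ?_
    simp [Lagrange.basisDivisor, div_eq_inv_mul]
  have h0 : ∏ j ∈ Finset.univ.erase k, ‖v k - v j‖ ≠ 0 := by
    refine Finset.prod_ne_zero_iff.mpr fun j hj => ?_
    rw [norm_ne_zero_iff, sub_ne_zero]
    exact fun h => (Finset.ne_of_mem_erase hj) (hv h).symm
  rw [h, norm_prod, ← Finset.mul_prod_erase Finset.univ (fun j => ‖x - v j‖) (Finset.mem_univ k)]
  simp only [norm_div, Finset.prod_div_distrib]
  field_simp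

/-- Serves the finitely many small `n` in the `log²` bound; one fundamental polynomial equals `1` at
its own node. -/
theorem one_le_lebesgueConstant {X : Set ℂ} [CompactSpace X] {n : ℕ}
    (z : Fin (n + 1) → X) (hz : Function.Injective z) : 1 ≤ lebesgueConstant z hz := by
  have hz' : Function.Injective (fun k => (z k : ℂ)) := Subtype.val_injective.comp hz
  refine le_trans ?_ (sum_norm_eval_basis_le_lebesgueConstant z hz (z 0))
  refine le_trans ?_ (Finset.single_le_sum (fun k _ => norm_nonneg _) (Finset.mem_univ 0))
  rw [Lagrange.eval_basis_self (hz'.injOn) (Finset.mem_univ _)]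
  simp

/-! ### Preimages of the Fejér points as roots of `±1` -/

/-- The common value `± 1` of the `(n + 1)`-st powers of the preimages of the Fejér points. -/
noncomputable def nodeSign (n : ℕ) : ℂ := if Even n then 1 else -1

theorem norm_nodeSign (n : ℕ) : ‖nodeSign n‖ = 1 := by
  unfold nodeSign; split_ifs <;> simp

theorem nodeSign_sq (n : ℕ) : nodeSign n ^ 2 = 1 := by
  unfold nodeSign; split_ifs <;> simp

/-- The preimages on the unit circle of the Fejér points. -/
noncomputable def node (n : ℕ) (k : Fin (n + 1)) : ℂ := exp (theta n k * I)

theorem norm_node (n : ℕ) (k : Fin (n + 1)) : ‖node n k‖ = 1 := norm_exp_ofReal_mul_I _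

theorem node_ne_zero (n : ℕ) (k : Fin (n + 1)) : node n k ≠ 0 := exp_ne_zero _

theorem node_injective (n : ℕ) : Function.Injective (node n) := fun j k h =>
  Fin.ext (exp_theta_injOn (Nat.lt_succ_iff.mp j.2) (Nat.lt_succ_iff.mp k.2) h)

theorem node_pow (n : ℕ) (k : Fin (n + 1)) : node n k ^ (n + 1) = nodeSign n :=
  exp_theta_pow (Nat.lt_succ_iff.mp k.2)

theorem node_add_one_ne_zero (n : ℕ) (k : Fin (n + 1)) : node n k + 1 ≠ 0 := by
  intro h
  have h1 : node n k = -1 := by linear_combination h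
  have h2 := node_pow n k
  rw [h1] at h2
  unfold nodeSign at h2
  split_ifs at h2 with hn
  · rw [hn.add_one.neg_one_pow] at h2; norm_num at h2
  · rw [(Nat.not_even_iff_odd.mp hn).add_one.neg_one_pow] at h2; norm_num at h2

/-- Both sides are monic of degree `n + 1` and vanish at the `n + 1` distinct nodes. -/
theorem nodal_node (n : ℕ) :
    Lagrange.nodal Finset.univ (node n) = X ^ (n + 1) - C (nodeSign n) := by
  have hmon : (X ^ (n + 1) - C (nodeSign n) : ℂ[X]).Monic := monic_X_pow_sub_C _ n.succ_ne_zero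
  have hdeg : (X ^ (n + 1) - C (nodeSign n) : ℂ[X]).natDegree = n + 1 := natDegree_X_pow_sub_C
  refine Polynomial.eq_of_degree_sub_lt_of_eval_index_eq (s := Finset.univ) (v := node n)
    (node_injective n).injOn ?_ ?_
  · refine (degree_sub_lt_left ?_ (Lagrange.nodal_ne_zero) ?_).trans_le ?_
    · rw [Lagrange.degree_nodal, degree_eq_natDegree hmon.ne_zero, hdeg]; simp
    · rw [Lagrange.nodal_monic.leadingCoeff, hmon.leadingCoeff]
    · rw [Lagrange.degree_nodal]
  · intro k hk
    rw [Lagrange.eval_nodal_at_node hk]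
    simp [node_pow]

theorem prod_sub_node (n : ℕ) (v : ℂ) : ∏ j, (v - node n j) = v ^ (n + 1) - nodeSign n := by
  rw [← Lagrange.eval_nodal, nodal_node]; simp

theorem prod_erase_node_sub_node (n : ℕ) (k : Fin (n + 1)) :
    ∏ j ∈ Finset.univ.erase k, (node n k - node n j) = (n + 1) * node n k ^ n := by
  rw [← Lagrange.eval_nodal,
    ← Lagrange.eval_nodal_derivative_eval_node_eq (Finset.mem_univ k), nodal_node]
  simp

theorem psi0_node_sq (n : ℕ) (k : Fin (n + 1)) :
    psi0 (node n k) ^ 2 = (node n k - 1) ^ 3 * (node n k + 1) / node n k ^ 2 :=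
  psi0_sq (node_ne_zero n k) (node_add_one_ne_zero n k)

/-! ### Products over the nodes through the four points of a fibre -/

section Quartic

variable {n : ℕ} {z w w' u v : ℂ}

/-- `w, w', u, v` are the four solutions of `psi0 ^ 2 = z ^ 2`. -/
def IsFibre (z w w' u v : ℂ) : Prop :=
  ∀ s : ℂ, (s - 1) ^ 3 * (s + 1) - z ^ 2 * s ^ 2 = (s - w) * (s - w') * (s - u) * (s - v)

/-- The quartic evaluated at a node `s` is `(ψ₀(s)² - z²) s²`, and `|s| = 1`. -/
theorem norm_sub_mul_norm_add (h : IsFibre z w w' u v) (j : Fin (n + 1)) :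
    ‖z - psi0 (node n j)‖ * ‖z + psi0 (node n j)‖ =
      ‖w - node n j‖ * ‖w' - node n j‖ * ‖u - node n j‖ * ‖v - node n j‖ := by
  have h1 : (z - psi0 (node n j)) * (z + psi0 (node n j)) * node n j ^ 2 =
      -((w - node n j) * (w' - node n j) * (u - node n j) * (v - node n j)) := by
    have := h (node n j)
    have h2 := psi0_node_sq n j
    rw [eq_div_iff (pow_ne_zero 2 (node_ne_zero n j))] at h2
    linear_combination -this - h2
  have := congrArg norm h1
  simpa only [norm_mul, norm_pow, norm_node, norm_neg, one_pow, mul_one] using this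

theorem prod_norm_sub_mul_prod_norm_add (h : IsFibre z w w' u v) :
    (∏ j, ‖z - psi0 (node n j)‖) * ∏ j, ‖z + psi0 (node n j)‖ =
      ‖w ^ (n + 1) - nodeSign n‖ * ‖w' ^ (n + 1) - nodeSign n‖ *
        ‖u ^ (n + 1) - nodeSign n‖ * ‖v ^ (n + 1) - nodeSign n‖ := by
  simp only [← prod_sub_node, norm_prod, ← Finset.prod_mul_distrib]
  exact Finset.prod_congr rfl fun j _ => norm_sub_mul_norm_add h j

/-- The version with the vanishing factor removed: for the root equal to the node itself, the
product of differences is the derivative of `X ^ (n + 1) - ε`, of modulus `n + 1`. -/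
theorem prod_erase_norm_sub_mul_prod_norm_add (k : Fin (n + 1))
    (h : IsFibre (psi0 (node n k)) (node n k) w' u v) :
    (∏ j ∈ Finset.univ.erase k, ‖psi0 (node n k) - psi0 (node n j)‖) *
      (∏ j ∈ Finset.univ.erase k, ‖psi0 (node n k) + psi0 (node n j)‖) *
      (‖w' - node n k‖ * ‖u - node n k‖ * ‖v - node n k‖) =
      (n + 1) * (‖w' ^ (n + 1) - nodeSign n‖ *
        ‖u ^ (n + 1) - nodeSign n‖ * ‖v ^ (n + 1) - nodeSign n‖) := by
  have h1 := congrArg norm (prod_erase_node_sub_node n k)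
  rw [norm_prod, norm_mul, norm_pow, norm_node, one_pow, mul_one,
    show ((n : ℂ) + 1) = ((n + 1 : ℕ) : ℂ) by push_cast; rfl, norm_natCast] at h1
  push_cast at h1
  rw [← h1]
  simp only [← prod_sub_node, norm_prod, ← Finset.prod_mul_distrib]
  rw [← Finset.mul_prod_erase Finset.univ (fun j => ‖w' - node n j‖ * ‖u - node n j‖ *
    ‖v - node n j‖) (Finset.mem_univ k)]
  simp only [norm_sub_mul_norm_add h, Finset.prod_mul_distrib]
  ring

end Quartic

/-! ### Jensen's formula and the mean of `log ‖z + ψ₀‖` on the circle -/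

open Metric Real InnerProductSpace

/-- **Jensen's formula** on the unit disc for a function with a single, simple zero, which need
only be continuous up to the boundary. -/
theorem circleAverage_log_norm_of_simple_zero {f : ℂ → ℂ} {a : ℂ}
    (hf : DifferentiableOn ℂ f (ball 0 1)) (hc : ContinuousOn f (closedBall 0 1))
    (ha : ‖a‖ < 1) (ha0 : a ≠ 0) (hfa : f a = 0) (hd : deriv f a ≠ 0)
    (h0 : ∀ u, ‖u‖ ≤ 1 → f u = 0 → u = a) :
    circleAverage (fun u => Real.log ‖f u‖) 0 1 = Real.log ‖f 0‖ - Real.log ‖a‖ := by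
  have hab : a ∈ ball (0 : ℂ) 1 := by simpa using ha
  have hnhds : ball (0 : ℂ) 1 ∈ nhds a := isOpen_ball.mem_nhds hab
  have hnhds' : closedBall (0 : ℂ) 1 ∈ nhds a := Filter.mem_of_superset hnhds ball_subset_closedBall
  -- Dividing out the zero leaves a function without zeros in the closed disc, so `log ‖g‖` has the
  -- mean value property; the factor `u - a` has logarithmic mean `0`.
  set g := dslope f a with hg
  have hgc : ContinuousOn g (closedBall 0 1) :=
    (continuousOn_dslope hnhds').mpr ⟨hc, hf.differentiableAt hnhds⟩
  have hgd : DifferentiableOn ℂ g (ball 0 1) :=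
    (differentiableOn_dslope hnhds).mpr hf
  have hgf : ∀ u, f u = (u - a) * g u := fun u => by
    have := sub_smul_dslope f a u
    rw [hfa, sub_zero, smul_eq_mul] at this
    exact this.symm
  have hg0 : ∀ u, ‖u‖ ≤ 1 → g u ≠ 0 := by
    intro u hu h
    have hua := h0 u hu (by rw [hgf, h, mul_zero])
    rw [hua, hg, dslope_same] at h
    exact hd h
  have hharm : HarmonicContOnCl (fun u => Real.log ‖g u‖) (ball (0 : ℂ) |1|) := by
    rw [abs_one]
    refine ⟨fun u hu => ?_, ?_⟩
    · exact AnalyticAt.harmonicAt_log_norm (hgd.analyticAt (isOpen_ball.mem_nhds hu))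
        (hg0 u (by simpa using (mem_ball_zero_iff.mp hu).le))
    · rw [closure_ball _ one_ne_zero]
      exact hgc.norm.log fun u hu => norm_ne_zero_iff.mpr (hg0 u (by simpa using hu))
  have h1 := hharm.circleAverage_eq
  have hg0' : g 0 = -f 0 / a := by rw [hgf 0]; field_simp; ring
  have h2 : circleAverage (fun u => Real.log ‖f u‖) 0 1 =
      circleAverage ((fun u => Real.log ‖u - a‖) + fun u => Real.log ‖g u‖) 0 1 := by
    refine circleAverage_congr_sphere fun u hu => ?_
    have hu1 : ‖u‖ = 1 := by simpa using hu
    have hua : u ≠ a := by rintro rfl; exact ha.ne hu1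
    simp only [Pi.add_apply]
    rw [hgf u, norm_mul, Real.log_mul (norm_ne_zero_iff.mpr (sub_ne_zero.mpr hua))
      (norm_ne_zero_iff.mpr (hg0 u hu1.le))]
  have hi1 : CircleIntegrable (fun u => Real.log ‖u - a‖) 0 1 := by
    refine ContinuousOn.circleIntegrable zero_le_one ?_
    refine ContinuousOn.log (by fun_prop) fun u hu => ?_
    rw [norm_ne_zero_iff, sub_ne_zero]
    rintro rfl
    exact ha.ne (by simpa using hu)
  have hi2 : CircleIntegrable (fun u => Real.log ‖g u‖) 0 1 := by
    refine ContinuousOn.circleIntegrable zero_le_one ?_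
    refine ContinuousOn.log ((hgc.mono sphere_subset_closedBall).norm) fun u hu => ?_
    exact norm_ne_zero_iff.mpr (hg0 u (by simpa using (mem_sphere_zero_iff_norm.mp hu).le))
  have hf0 : f 0 ≠ 0 := fun h => ha0 (h0 0 (by simp) h).symm
  rw [h2, circleAverage_add hi1 hi2, circleAverage_log_norm_sub_const₀ ha, h1, hg0', zero_add,
    norm_div, norm_neg, Real.log_div (norm_ne_zero_iff.mpr hf0) (norm_ne_zero_iff.mpr ha0)]

theorem cpow_half_sq (q : ℂ) : (q ^ (1 / 2 : ℂ)) ^ 2 = q := by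
  rw [← cpow_nat_mul]; norm_num

/-- The principal root halves the argument, so it lies in the open sector of half-angle `π/4`. -/
theorem abs_im_lt_re_cpow_half {q : ℂ} (hq : 0 < q.re) :
    |(q ^ (1 / 2 : ℂ)).im| < (q ^ (1 / 2 : ℂ)).re := by
  have hq0 : q ≠ 0 := by rintro rfl; simp at hq
  have hpos : 0 < (q ^ (1 / 2 : ℂ)).re := by
    rw [cpow_def_of_ne_zero hq0, exp_re]
    have : (log q * (1 / 2)).im = q.arg / 2 := by
      rw [show (log q * (1 / 2) : ℂ) = log q * ((1 / 2 : ℝ) : ℂ) by push_cast; rfl, im_mul_ofReal,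
        log_im]; ring
    rw [this]
    have h1 := neg_pi_lt_arg q
    have h2 := arg_le_pi q
    have h3 := (abs_arg_lt_pi_div_two_iff.mpr (Or.inl hq))
    rw [abs_lt] at h3
    have : 0 < Real.cos (q.arg / 2) :=
      Real.cos_pos_of_mem_Ioo ⟨by linarith [Real.pi_pos], by linarith [Real.pi_pos]⟩
    positivity
  have h := congrArg re (cpow_half_sq q)
  rw [sq, mul_re] at h
  rw [abs_lt]
  constructor <;> nlinarith

/-- The function `u * psi0 (1 / u)`, continuous on the closed unit disc. -/
noncomputable def psiInv (u : ℂ) : ℂ := (1 - u ^ 2) * ((1 - u) / (1 + u)) ^ (1 / 2 : ℂ)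

theorem psiInv_sq (u : ℂ) : psiInv u ^ 2 = (1 - u) ^ 3 * (1 + u) := by
  unfold psiInv
  rw [mul_pow, cpow_half_sq]
  by_cases h : 1 + u = 0
  · rw [h]; simp [show u = -1 by linear_combination h]
  · field_simp; ring

theorem psiInv_eq {u : ℂ} (hu : u ≠ 0) : psiInv u = u * psi0 (1 / u) := by
  unfold psiInv psi0
  have : (1 / u - 1) / (1 / u + 1) = (1 - u) / (1 + u) := by
    rw [← div_div_div_cancel_right₀ hu (1 - u) (1 + u)]
    congr 1 <;> field_simp
  rw [this]; field_simp

theorem re_one_sub_div_one_add (u : ℂ) :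
    ((1 - u) / (1 + u)).re = (1 - ‖u‖ ^ 2) / normSq (1 + u) := by
  rw [div_re, ← add_div, ← normSq_eq_norm_sq, normSq_apply u]
  congr 1
  simp
  ring

theorem one_sub_div_one_add_mem_slitPlane {u : ℂ} (hu : ‖u‖ ≤ 1) (h1 : u ≠ 1) (h2 : u ≠ -1) :
    (1 - u) / (1 + u) ∈ slitPlane := by
  have h2' : 1 + u ≠ 0 := fun h => h2 (by linear_combination h)
  rw [mem_slitPlane_iff]
  by_contra! h
  have hre : 0 ≤ ((1 - u) / (1 + u)).re := by
    rw [re_one_sub_div_one_add]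
    refine div_nonneg ?_ (normSq_nonneg _)
    nlinarith [norm_nonneg u]
  have : (1 - u) / (1 + u) = 0 := Complex.ext (le_antisymm h.1 hre) h.2
  rw [div_eq_zero_iff, or_iff_left h2'] at this
  exact h1 (by linear_combination -this)

theorem differentiableOn_psiInv : DifferentiableOn ℂ psiInv (ball 0 1) := by
  intro u hu
  have hu1 : ‖u‖ < 1 := by simpa using hu
  have h1 : u ≠ 1 := by rintro rfl; simp at hu1
  have h2 : u ≠ -1 := by rintro rfl; simp at hu1
  have h2' : 1 + u ≠ 0 := fun h => h2 (by linear_combination h)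
  unfold psiInv
  refine DifferentiableAt.differentiableWithinAt ?_
  refine DifferentiableAt.mul (by fun_prop) (DifferentiableAt.cpow_const ?_ ?_)
  · exact DifferentiableAt.div (by fun_prop) (by fun_prop) h2'
  · exact one_sub_div_one_add_mem_slitPlane hu1.le h1 h2

theorem continuousOn_psiInv : ContinuousOn psiInv (closedBall 0 1) := by
  intro u hu
  have hu1 : ‖u‖ ≤ 1 := by simpa using hu
  by_cases h : u = 1 ∨ u = -1
  · have h0 : psiInv u = 0 := by
      have := psiInv_sq u
      rcases h with rfl | rfl
      · exact pow_eq_zero_iff two_ne_zero |>.mp (this.trans (by ring))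
      · exact pow_eq_zero_iff two_ne_zero |>.mp (this.trans (by ring))
    -- At `±1` the quotient under the root is `0` or singular. The squared formula still gives
    -- continuity there, because the value is `0`.
    have hn : ∀ v, ‖psiInv v‖ = √‖(1 - v) ^ 3 * (1 + v)‖ := fun v => by
      rw [← psiInv_sq, norm_pow, Real.sqrt_sq (norm_nonneg _)]
    refine ContinuousAt.continuousWithinAt ?_
    rw [ContinuousAt, h0, tendsto_zero_iff_norm_tendsto_zero]
    simp only [hn]
    have : Filter.Tendsto (fun v : ℂ => √‖(1 - v) ^ 3 * (1 + v)‖) (nhds u)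
        (nhds (√‖(1 - u) ^ 3 * (1 + u)‖)) := by
      apply Continuous.tendsto; fun_prop
    rwa [← hn, h0, norm_zero] at this
  · push Not at h
    have h2' : 1 + u ≠ 0 := fun h' => h.2 (by linear_combination h')
    unfold psiInv
    refine ContinuousAt.continuousWithinAt ?_
    refine ContinuousAt.mul (by fun_prop) (ContinuousAt.cpow ?_ (by fun_prop) ?_)
    · exact ContinuousAt.div (by fun_prop) (by fun_prop) h2'
    · exact one_sub_div_one_add_mem_slitPlane hu1 h.1 h.2

theorem psi0_neg_one : psi0 (-1) = 0 := by simp [psi0]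

theorem re_psi0_nonpos {w : ℂ} (hw : ‖w‖ = 1) : (psi0 w).re ≤ 0 := by
  have hw' : w = exp (w.arg * I) := by
    conv_lhs => rw [← norm_mul_exp_arg_mul_I w, hw]
    simp
  rcases (arg_le_pi w).eq_or_lt with h | h
  · rw [hw', h, exp_pi_mul_I, psi0_neg_one]; simp
  · have := psi0_exp_mem (neg_pi_lt_arg w) h
    rw [← hw'] at this
    rcases this with ⟨x, hx, h⟩ | ⟨x, hx, h⟩
    · rw [← h]; simpa using hx.1
    · rw [← h]; simpa using hx.1

section Quartic

variable {z w w' u v : ℂ}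

theorem IsFibre.reverse (h : IsFibre z w w' u v) (s : ℂ) :
    (1 - s) ^ 3 * (1 + s) - z ^ 2 * s ^ 2 =
      (1 - w * s) * (1 - w' * s) * (1 - u * s) * (1 - v * s) := by
  by_cases hs : s = 0
  · simp [hs]
  have h1 := h (1 / s)
  field_simp at h1
  linear_combination h1

/-- Squaring leaves only the sign to decide. The factor `u - 1/u` has argument in `(-π/2, 0)` and
the root factor in `(-π/4, π/4)`, so the product cannot point in the direction `3π/4` of `z`. -/
theorem psi0_eq_neg_of_isFibre (h : IsFibre z w w' u v) {x : ℝ} (hx : 0 < x)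
    (hz : z = (-1 + I) * x) (hu : 1 < ‖u‖) (hre : 0 < (u - 1 / u).re)
    (him : (u - 1 / u).im < 0) : psi0 u = -z := by
  have hu0 : u ≠ 0 := by rintro rfl; simp at hu; linarith
  have hu1 : u + 1 ≠ 0 := by
    intro h
    rw [show u = -1 by linear_combination h] at hu; simp at hu
  have hq : psi0 u ^ 2 = z ^ 2 := by
    have := h u
    rw [psi0_sq hu0 hu1, div_eq_iff (pow_ne_zero 2 hu0)]
    linear_combination this
  rcases sq_eq_sq_iff_eq_or_eq_neg.mp hq with h1 | h1
  swap
  · exact h1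
  exfalso
  have hre2 : 0 < ((u - 1) / (u + 1)).re := by
    rw [div_re, ← add_div]
    refine div_pos ?_ (normSq_pos.mpr hu1)
    have : 1 < normSq u := by rw [normSq_eq_norm_sq]; nlinarith
    rw [normSq_apply] at this
    simp
    nlinarith
  have hb := abs_im_lt_re_cpow_half hre2
  rw [abs_lt] at hb
  unfold psi0 at h1
  set a := u - 1 / u
  set b := ((u - 1) / (u + 1)) ^ (1 / 2 : ℂ)
  rw [hz] at h1
  have e1 := congrArg re h1
  have e2 := congrArg im h1
  simp at e1 e2
  nlinarith [mul_pos hre (by linarith [hb.2] : 0 < b.re - b.im),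
    mul_pos (neg_pos.mpr him) (by linarith [hb.1] : 0 < b.re + b.im)]

/-- The function has modulus `1` at `0`, and its product with `-z s + psiInv s` is the reversed
quartic up to sign. So its zeros are among the reciprocals of the fibre: `1/v` lies outside the
disc, and zeros on the circle are excluded by `Re ψ₀ ≤ 0 < Re (-z)`. Only the simple zero `1/u`
remains. -/
theorem circleAverage_log_norm_psiInv (h : IsFibre z w w' u v) (hw : ‖w‖ = 1) (hw' : ‖w'‖ = 1)
    (hu : 1 < ‖u‖) (hv : ‖v‖ < 1) (hz : z.re < 0) (hpsi : psi0 u = -z) :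
    circleAverage (fun s => Real.log ‖-z * s - psiInv s‖) 0 1 = Real.log ‖u‖ := by
  have hu0 : u ≠ 0 := by rintro rfl; simp at hu; linarith
  have hu' : ‖u⁻¹‖ < 1 := by rw [norm_inv]; exact inv_lt_one_of_one_lt₀ hu
  have hub : u⁻¹ ∈ ball (0 : ℂ) 1 := by simpa using hu'
  have hz0 : z ≠ 0 := by rintro rfl; simp at hz
  have hua : psiInv u⁻¹ = -z * u⁻¹ := by
    rw [psiInv_eq (inv_ne_zero hu0), one_div, inv_inv, hpsi, mul_comm]
  have hdiff : DifferentiableAt ℂ psiInv u⁻¹ :=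
    differentiableOn_psiInv.differentiableAt (isOpen_ball.mem_nhds hub)
  have hne : ∀ {y s : ℂ}, ‖y‖ ≤ 1 → ‖s‖ < 1 → 1 - y * s ≠ 0 := by
    intro y s hy hs h0
    have : ‖y * s‖ = 1 := by rw [← sub_eq_zero.mp h0]; simp
    rw [norm_mul] at this
    nlinarith [norm_nonneg y, norm_nonneg s]
  have hmain := circleAverage_log_norm_of_simple_zero (f := fun s => -z * s - psiInv s)
    (a := u⁻¹) ((by fun_prop : DifferentiableOn ℂ (fun s : ℂ => -z * s) _).sub
      differentiableOn_psiInv)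
    ((by fun_prop : ContinuousOn (fun s : ℂ => -z * s) _).sub continuousOn_psiInv) hu'
    (inv_ne_zero hu0) (by simp [hua]) ?_ ?_
  · rw [hmain]
    simp [psiInv]
  · have hd : HasDerivAt (fun s => -z * s - psiInv s) (deriv (fun s => -z * s - psiInv s) u⁻¹)
        u⁻¹ := DifferentiableAt.hasDerivAt
          ((by fun_prop : DifferentiableAt ℂ (fun s : ℂ => -z * s) _).sub hdiff)
    intro h0
    rw [h0] at hd
    have hd2 : DifferentiableAt ℂ (fun s => -z * s + psiInv s) u⁻¹ :=
      (by fun_prop : DifferentiableAt ℂ (fun s : ℂ => -z * s) _).add hdiff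
    have hprod := hd.mul hd2.hasDerivAt
    simp only [hua, zero_mul, sub_self, add_zero] at hprod
    have heq : ((fun s => -z * s - psiInv s) * fun s => -z * s + psiInv s) =
        fun s => (s - u⁻¹) * (u * ((1 - w * s) * (1 - w' * s) * (1 - v * s))) := by
      funext s
      have := h.reverse s
      have h2 := psiInv_sq s
      simp only [Pi.mul_apply]
      have h3 : (s - u⁻¹) * u = -(1 - u * s) := by field_simp; ring
      linear_combination -this - h2 - (1 - w * s) * (1 - w' * s) * (1 - v * s) * h3
    rw [heq] at hprod
    have hd3 := ((hasDerivAt_id (u⁻¹)).sub_const u⁻¹).mul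
      ((by fun_prop : DifferentiableAt ℂ
        (fun s => u * ((1 - w * s) * (1 - w' * s) * (1 - v * s))) u⁻¹).hasDerivAt)
    have := hprod.unique hd3
    simp only [id, one_mul, sub_self, zero_mul, add_zero] at this
    have h4 := mul_ne_zero hu0 (mul_ne_zero (mul_ne_zero (hne hw.le hu') (hne hw'.le hu'))
      (hne hv.le hu'))
    exact h4 this.symm
  · intro s hs h0
    have h1 : (1 - w * s) * (1 - w' * s) * (1 - u * s) * (1 - v * s) = 0 := by
      rw [← h.reverse, ← psiInv_sq]
      linear_combination (-psiInv s + z * s) * h0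
    have hs0 : s ≠ 0 := by
      rintro rfl
      simp [psiInv] at h0
    have hcirc : ∀ y : ℂ, ‖y‖ = 1 → 1 - y * s ≠ 0 := by
      intro y hy hys
      have hy' : 1 / s = y := by field_simp; linear_combination hys
      have hre := re_psi0_nonpos hy
      rw [psiInv_eq hs0, hy'] at h0
      have : psi0 y = -z := mul_left_cancel₀ hs0 (by linear_combination -h0)
      rw [this] at hre
      simp at hre
      linarith
    have hv' : 1 - v * s ≠ 0 := by
      rw [mul_comm]; exact hne hs hv
    have h2 := (mul_eq_zero.mp ((mul_eq_zero.mp h1).resolve_right hv')).resolve_left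
      (mul_ne_zero (hcirc w hw) (hcirc w' hw'))
    field_simp
    linear_combination -h2

end Quartic

/-! ### Quadrature at the Fejér angles -/

theorem thetaUpper_eq (n j : ℕ) :
    thetaUpper n j = 2 * π / (n + 1) * ((if Even n then 0 else 1 / 2) + j) := by
  unfold thetaUpper
  split_ifs <;> field_simp <;> ring

theorem thetaUpper_zero_of_even {n : ℕ} (hn : Even n) : thetaUpper n 0 = 0 := by
  simp [thetaUpper, hn]

theorem thetaUpper_mem {n j : ℕ} (hj : j ≤ n / 2) : 0 ≤ thetaUpper n j ∧ thetaUpper n j < π := by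
  constructor
  · unfold thetaUpper; split_ifs <;> positivity
  · have := (theta_mem (n := n) (k := j) (by omega)).2
    rwa [theta, if_pos hj] at this

/-- The quadrature error for a monotone function at the Fejér angles in `[0, π)`. -/
theorem abs_sum_thetaUpper_sub_integral_le {g : ℝ → ℝ} (hg : Monotone g) {B : ℝ}
    (h0 : ∀ t, 0 ≤ g t) (hB : ∀ t, g t ≤ B) (n : ℕ) :
    |∑ j ∈ Finset.range (n / 2 + 1), g (thetaUpper n j) -
      (n + 1) / (2 * π) * ∫ t in (0)..π, g t| ≤ B := by
  have hB0 : 0 ≤ B := (h0 0).trans (hB 0)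
  have hpi := Real.pi_pos
  have hii : ∀ a b : ℝ, IntervalIntegrable g MeasureTheory.volume a b := fun a b =>
    hg.intervalIntegrable
  set h : ℝ := 2 * π / (n + 1) with hh
  have hpos : 0 < h := by positivity
  set o : ℝ := if Even n then 0 else 1 / 2 with ho
  have ho0 : 0 ≤ o ∧ o ≤ 1 / 2 := by rw [ho]; split_ifs <;> norm_num
  -- In both parities the grid ends half a cell beyond `π`, which allows one argument for even and
  -- odd `n`.
  have hend : h * (o + (n / 2 + 1 : ℕ)) = π + h / 2 := by
    rw [hh, ho]
    rcases Nat.even_or_odd' n with ⟨m, hm | hm⟩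
    · have : n / 2 = m := by omega
      rw [if_pos (by simp [hm]), this, hm]; push_cast; field_simp; ring
    · have : n / 2 = m := by omega
      rw [if_neg (by simp [hm]), this, hm]; push_cast; field_simp; ring
  have hmono : ∀ s : Set ℝ, MonotoneOn (fun x => g (h * x)) s := fun s x _ y _ hxy =>
    hg (mul_le_mul_of_nonneg_left hxy hpos.le)
  have hbd : ∀ {a b : ℝ}, a ≤ b → 0 ≤ ∫ t in a..b, g t ∧ ∫ t in a..b, g t ≤ (b - a) * B := by
    intro a b hab
    constructor
    · exact intervalIntegral.integral_nonneg hab fun t _ => h0 t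
    · have := intervalIntegral.integral_mono_on hab (hii a b)
        (intervalIntegrable_const (c := B)) fun t _ => hB t
      simpa using this
  have hsum : ∑ j ∈ Finset.range (n / 2 + 1), g (thetaUpper n j) =
      ∑ j ∈ Finset.range (n / 2 + 1), g (h * (o + j)) :=
    Finset.sum_congr rfl fun j _ => by rw [thetaUpper_eq]
  have hle := (hmono (Set.Icc o (o + (n / 2 + 1 : ℕ)))).sum_le_integral
  -- Shifting the interval one cell to the left makes the same samples right endpoints instead of
  -- left endpoints.
  have hge := (hmono (Set.Icc (o - 1) ((o - 1) + (n / 2 + 1 : ℕ)))).integral_le_sum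
  have hge' : ∑ i ∈ Finset.range (n / 2 + 1), g (h * (o - 1 + ((i + 1 : ℕ) : ℝ))) =
      ∑ j ∈ Finset.range (n / 2 + 1), g (h * (o + j)) :=
    Finset.sum_congr rfl fun j _ => by congr 2; push_cast; ring
  rw [hge'] at hge
  rw [intervalIntegral.integral_comp_mul_left _ hpos.ne', smul_eq_mul, hend] at hle
  rw [intervalIntegral.integral_comp_mul_left _ hpos.ne', smul_eq_mul,
    show h * (o - 1 + (n / 2 + 1 : ℕ)) = π - h / 2 by linear_combination hend] at hge
  have hinv : (n + 1) / (2 * π) = h⁻¹ := by rw [hh, inv_div]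
  rw [hsum, hinv]
  set S := ∑ j ∈ Finset.range (n / 2 + 1), g (h * (o + j))
  have h1 : h * S ≤ ∫ t in (h * o)..(π + h / 2), g t := by
    have := mul_le_mul_of_nonneg_left hle hpos.le
    rwa [← mul_assoc, mul_inv_cancel₀ hpos.ne', one_mul] at this
  have h2 : ∫ t in (h * (o - 1))..(π - h / 2), g t ≤ h * S := by
    have := mul_le_mul_of_nonneg_left hge hpos.le
    rwa [← mul_assoc, mul_inv_cancel₀ hpos.ne', one_mul] at this
  have e1 : (∫ t in (0)..(h * o), g t) + ∫ t in (h * o)..(π + h / 2), g t =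
      (∫ t in (0)..π, g t) + ∫ t in π..(π + h / 2), g t := by
    rw [intervalIntegral.integral_add_adjacent_intervals (hii _ _) (hii _ _),
      intervalIntegral.integral_add_adjacent_intervals (hii _ _) (hii _ _)]
  have e2 : (∫ t in (h * (o - 1))..0, g t) + ∫ t in (0)..π, g t =
      (∫ t in (h * (o - 1))..(π - h / 2), g t) + ∫ t in (π - h / 2)..π, g t := by
    rw [intervalIntegral.integral_add_adjacent_intervals (hii _ _) (hii _ _),
      intervalIntegral.integral_add_adjacent_intervals (hii _ _) (hii _ _)]
  have b1 := hbd (show (0 : ℝ) ≤ h * o by have := ho0.1; positivity)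
  have b2 := hbd (show π ≤ π + h / 2 by linarith)
  have b3 := hbd (show h * (o - 1) ≤ 0 by nlinarith [ho0.2])
  have b4 := hbd (show π - h / 2 ≤ π by linarith)
  have hhB : h / 2 * B ≤ h * B := by nlinarith [mul_nonneg hpos.le hB0]
  rw [abs_le]
  have e3 : h * (S - h⁻¹ * ∫ t in (0)..π, g t) = h * S - ∫ t in (0)..π, g t := by
    rw [mul_sub, ← mul_assoc, mul_inv_cancel₀ hpos.ne', one_mul]
  constructor
  · refine le_of_mul_le_mul_left ?_ hpos
    rw [e3]
    linarith [b4.2, b3.1, e2]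
  · refine le_of_mul_le_mul_left ?_ hpos
    rw [e3]
    linarith [b1.1, b2.2, e1]

/-- The quadrature error for a function that increases up to `a` and decreases afterwards. -/
theorem abs_sum_thetaUpper_sub_integral_le_of_unimodal {f : ℝ → ℝ} {a B : ℝ}
    (ha : 0 ≤ a) (ha' : a ≤ π) (h1 : MonotoneOn f (Set.Icc 0 a)) (h2 : AntitoneOn f (Set.Icc a π))
    (h0 : ∀ t ∈ Set.Icc 0 π, 0 ≤ f t) (hB : ∀ t ∈ Set.Icc 0 π, f t ≤ B) (n : ℕ) :
    |∑ j ∈ Finset.range (n / 2 + 1), f (thetaUpper n j) -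
      (n + 1) / (2 * π) * ∫ t in (0)..π, f t| ≤ 2 * B := by
  -- Clamping to `[0, a]` and to `[a, π]` writes `f` as a difference of two monotone functions, each
  -- costing an error `B`.
  let p : ℝ → ℝ := fun t => max 0 (min t a)
  let q : ℝ → ℝ := fun t => min π (max t a)
  have hp : ∀ t, p t ∈ Set.Icc 0 a := fun t =>
    ⟨le_max_left _ _, max_le ha (min_le_right _ _)⟩
  have hq : ∀ t, q t ∈ Set.Icc a π := fun t =>
    ⟨le_min ha' (le_max_right _ _), min_le_left _ _⟩
  have haI : a ∈ Set.Icc 0 π := ⟨ha, ha'⟩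
  have hpI : ∀ t, p t ∈ Set.Icc 0 π := fun t => ⟨(hp t).1, (hp t).2.trans ha'⟩
  have hqI : ∀ t, q t ∈ Set.Icc 0 π := fun t => ⟨ha.trans (hq t).1, (hq t).2⟩
  have m1 : Monotone fun t => f (p t) := fun s t hst =>
    h1 (hp s) (hp t) (max_le_max le_rfl (min_le_min hst le_rfl))
  have m2 : Monotone fun t => f a - f (q t) := fun s t hst =>
    sub_le_sub_left (h2 (hq s) (hq t) (min_le_min le_rfl (max_le_max hst le_rfl))) _
  have r1 := abs_sum_thetaUpper_sub_integral_le m1 (fun t => h0 _ (hpI t))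
    (fun t => hB _ (hpI t)) n
  have r2 := abs_sum_thetaUpper_sub_integral_le m2 (B := B)
    (fun t => sub_nonneg.mpr (h2 ⟨le_rfl, ha'⟩ (hq t) (hq t).1))
    (fun t => by linarith [h0 _ (hqI t), hB a haI]) n
  have hf : ∀ t ∈ Set.Icc 0 π, f t = f (p t) - (f a - f (q t)) := by
    rintro t ⟨ht0, ht1⟩
    rcases le_total t a with h | h
    · have e1 : p t = t := by simp [p, h, ht0]
      have e2 : q t = a := by simp [q, h, ha']
      rw [e1, e2]; ring
    · have e1 : p t = a := by simp [p, h, ha]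
      have e2 : q t = t := by simp [q, h, ht1]
      rw [e1, e2]; ring
  have hint : ∫ t in (0)..π, f t = (∫ t in (0)..π, f (p t)) - ∫ t in (0)..π, (f a - f (q t)) := by
    rw [← intervalIntegral.integral_sub m1.intervalIntegrable m2.intervalIntegrable]
    refine intervalIntegral.integral_congr fun t ht => ?_
    rw [Set.uIcc_of_le Real.pi_pos.le] at ht
    exact hf t ht
  have hsum : ∑ j ∈ Finset.range (n / 2 + 1), f (thetaUpper n j) =
      ∑ j ∈ Finset.range (n / 2 + 1), f (p (thetaUpper n j)) -
      ∑ j ∈ Finset.range (n / 2 + 1), (f a - f (q (thetaUpper n j))) := by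
    rw [← Finset.sum_sub_distrib]
    refine Finset.sum_congr rfl fun j hj => hf _ ?_
    have := thetaUpper_mem (Nat.lt_succ_iff.mp (Finset.mem_range.mp hj))
    exact ⟨this.1, this.2.le⟩
  rw [hint, hsum, abs_le] at *
  constructor <;> rw [mul_sub] <;> linarith [r1.1, r1.2, r2.1, r2.2]

/-- For even `n` the angle `0` is its own reflection and would be counted twice. -/
theorem sum_theta_eq (n : ℕ) (G : ℝ → ℝ) :
    ∑ k : Fin (n + 1), G (theta n k) =
      ∑ j ∈ Finset.range (n / 2 + 1), (G (thetaUpper n j) + G (-thetaUpper n j)) -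
        if Even n then G 0 else 0 := by
  rw [Finset.sum_range (fun k => G (theta n k)) |>.symm, Finset.sum_add_distrib]
  set m := n / 2 with hm
  have hup : ∑ k ∈ Finset.range (m + 1), G (theta n k) =
      ∑ k ∈ Finset.range (m + 1), G (thetaUpper n k) :=
    Finset.sum_congr rfl fun k hk => by
      rw [theta, if_pos (Nat.lt_succ_iff.mp (Finset.mem_range.mp hk))]
  have hlow : ∀ i, G (theta n (m + 1 + i)) = G (-thetaUpper n (m - i)) := fun i => by
    rw [theta, if_neg (by omega)]
    congr 3; omega
  have hrefl : ∑ i ∈ Finset.range (m + 1), G (-thetaUpper n (m - i)) =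
      ∑ k ∈ Finset.range (m + 1), G (-thetaUpper n k) :=
    (Finset.sum_range_reflect (fun k => G (-thetaUpper n k)) (m + 1))
  rcases Nat.even_or_odd' n with ⟨c, hc | hc⟩
  · have hev : Even n := by simp [hc]
    rw [if_pos hev, show n + 1 = (m + 1) + m by omega, Finset.sum_range_add, hup, ← hrefl,
      Finset.sum_range_succ (fun i => G (-thetaUpper n (m - i))) m, Nat.sub_self, thetaUpper_zero_of_even hev, neg_zero]
    simp only [hlow]
    ring
  · rw [if_neg (by simp [hc]), show n + 1 = (m + 1) + (m + 1) by omega, Finset.sum_range_add, hup,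
      ← hrefl]
    simp only [hlow]
    ring

/-! ### The radius along the arc and the product of distances to `-z` -/

/-- The real and imaginary parts of `psi0 (exp (± t * I))` are `± radius t`. -/
noncomputable def radius (t : ℝ) : ℝ := 2 * Real.sin t * √(Real.tan (t / 2) / 2)

theorem psi0_exp_pos {t : ℝ} (h1 : 0 ≤ t) (h2 : t ≤ π) :
    psi0 (exp (t * I)) = (-1 + I) * radius t := by
  rcases h2.eq_or_lt with rfl | h2
  · rw [exp_pi_mul_I, psi0_neg_one]; simp [radius]
  rw [psi0_exp (by linarith [Real.pi_pos]) h2]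
  have hx : 0 ≤ Real.tan (t / 2) :=
    Real.tan_nonneg_of_nonneg_of_le_pi_div_two (by linarith) (by linarith)
  rw [(mul_I_cpow_half hx).1, radius]
  push_cast
  linear_combination (2 * Complex.sin t * √(Real.tan (t / 2) / 2)) * I_sq

theorem psi0_exp_neg {t : ℝ} (h1 : 0 ≤ t) (h2 : t ≤ π) :
    psi0 (exp ((-t : ℝ) * I)) = (-1 - I) * radius t := by
  rcases h2.eq_or_lt with rfl | h2
  · rw [ofReal_neg, neg_mul, Complex.exp_neg, exp_pi_mul_I, inv_neg, inv_one, psi0_neg_one]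
    simp [radius]
  rw [psi0_exp (by linarith) (by linarith [Real.pi_pos])]
  have hx : 0 ≤ Real.tan (t / 2) :=
    Real.tan_nonneg_of_nonneg_of_le_pi_div_two (by linarith) (by linarith)
  have hx' : Real.tan (-t / 2) = -Real.tan (t / 2) := by rw [← Real.tan_neg]; congr 1; ring
  rw [hx', (mul_I_cpow_half hx).2, radius]
  simp only [Real.sin_neg, ofReal_neg, ofReal_mul, ofReal_ofNat]
  linear_combination (2 * (Real.sin t : ℂ) * √(Real.tan (t / 2) / 2)) * I_sq

theorem radius_nonneg {t : ℝ} (h1 : 0 ≤ t) (h2 : t ≤ π) : 0 ≤ radius t := by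
  have := Real.sin_nonneg_of_nonneg_of_le_pi h1 h2
  unfold radius; positivity

/-- The fourth power is a polynomial in `cos t`, maximal at `cos t = -1/2`; the tip of the segment
is therefore at `t = 2π/3`. -/
theorem radius_pow_four {t : ℝ} (h1 : 0 ≤ t) (h2 : t ≤ π) :
    radius t ^ 4 = 4 * (1 - Real.cos t) ^ 3 * (1 + Real.cos t) := by
  rcases h2.eq_or_lt with rfl | h2
  · simp [radius]
  have hc : 0 < Real.cos (t / 2) := Real.cos_pos_of_mem_Ioo ⟨by linarith, by linarith⟩
  have hs : 0 ≤ Real.sin (t / 2) :=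
    Real.sin_nonneg_of_nonneg_of_le_pi (by linarith) (by linarith)
  have hsc := Real.sin_sq_add_cos_sq (t / 2)
  have hd : Real.sin t = 2 * Real.sin (t / 2) * Real.cos (t / 2) := by
    rw [← Real.sin_two_mul]; congr 1; ring
  have hcd : Real.cos t = 2 * Real.cos (t / 2) ^ 2 - 1 := by
    rw [← Real.cos_two_mul]; congr 1; ring
  have hsq : √(Real.tan (t / 2) / 2) ^ 2 = Real.tan (t / 2) / 2 := by
    refine Real.sq_sqrt ?_
    rw [Real.tan_eq_sin_div_cos]; positivity
  unfold radius
  rw [mul_pow, show √(Real.tan (t / 2) / 2) ^ 4 = (√(Real.tan (t / 2) / 2) ^ 2) ^ 2 by ring, hsq,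
    hd, hcd, Real.tan_eq_sin_div_cos,
    show 1 - (2 * Real.cos (t / 2) ^ 2 - 1) = 2 * Real.sin (t / 2) ^ 2 by linarith]
  field_simp
  ring

theorem cos_two_pi_div_three : Real.cos (2 * π / 3) = -1 / 2 := by
  rw [show 2 * π / 3 = π - π / 3 by ring, Real.cos_pi_sub, Real.cos_pi_div_three]; norm_num

theorem radius_le_two {t : ℝ} (h1 : 0 ≤ t) (h2 : t ≤ π) : radius t ≤ 2 := by
  refine le_of_pow_le_pow_left₀ (n := 4) (by norm_num) (by norm_num) ?_
  rw [radius_pow_four h1 h2]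
  have ha := Real.neg_one_le_cos t
  have hb := Real.cos_le_one t
  nlinarith [mul_nonneg (sq_nonneg (2 * Real.cos t + 1))
    (by nlinarith [sq_nonneg (2 * Real.cos t - 3)] :
      0 ≤ 4 * Real.cos t ^ 2 - 12 * Real.cos t + 11)]

theorem monotoneOn_radius : MonotoneOn radius (Set.Icc 0 (2 * π / 3)) := by
  rintro s ⟨hs0, hs1⟩ t ⟨ht0, ht1⟩ hst
  have hpi := Real.pi_pos
  refine le_of_pow_le_pow_left₀ (n := 4) (by norm_num)
    (radius_nonneg ht0 (by linarith)) ?_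
  rw [radius_pow_four hs0 (by linarith), radius_pow_four ht0 (by linarith)]
  have h1 : Real.cos t ≤ Real.cos s :=
    Real.cos_le_cos_of_nonneg_of_le_pi hs0 (by linarith) hst
  have h2 : Real.cos (2 * π / 3) ≤ Real.cos t :=
    Real.cos_le_cos_of_nonneg_of_le_pi ht0 (by linarith) ht1
  rw [cos_two_pi_div_three] at h2
  obtain ⟨a, ha⟩ : ∃ a, a = 1 - Real.cos t := ⟨_, rfl⟩
  obtain ⟨b, hb⟩ : ∃ b, b = 1 - Real.cos s := ⟨_, rfl⟩
  have ht' : Real.cos t = 1 - a := by linarith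
  have hs' : Real.cos s = 1 - b := by linarith
  have hb0 : 0 ≤ b := by linarith [Real.cos_le_one s]
  have key : 0 ≤ 2 * (a ^ 2 + a * b + b ^ 2) - (a + b) * (a ^ 2 + b ^ 2) := by
    have hab : b ≤ a := by linarith
    have ha1 : 0 ≤ 3 / 2 - a := by linarith
    nlinarith [mul_nonneg (sq_nonneg a) ha1, mul_nonneg (sq_nonneg b) (by linarith : 0 ≤ 3 / 2 - b),
      mul_nonneg (mul_nonneg (hb0.trans hab) hb0) (by linarith : 0 ≤ 3 - a - b), sq_nonneg (a - b)]
  rw [ht', hs']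
  nlinarith [mul_nonneg (by linarith : 0 ≤ a - b) key]

theorem antitoneOn_radius : AntitoneOn radius (Set.Icc (2 * π / 3) π) := by
  rintro s ⟨hs0, hs1⟩ t ⟨ht0, ht1⟩ hst
  have hpi := Real.pi_pos
  refine le_of_pow_le_pow_left₀ (n := 4) (by norm_num)
    (radius_nonneg (by linarith) (by linarith)) ?_
  rw [radius_pow_four (by linarith) (by linarith), radius_pow_four (by linarith) (by linarith)]
  have h1 : Real.cos t ≤ Real.cos s :=
    Real.cos_le_cos_of_nonneg_of_le_pi (by linarith) (by linarith) hst
  have h2 : Real.cos s ≤ Real.cos (2 * π / 3) :=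
    Real.cos_le_cos_of_nonneg_of_le_pi (by positivity) (by linarith) hs0
  rw [cos_two_pi_div_three] at h2
  obtain ⟨a, ha⟩ : ∃ a, a = 1 - Real.cos t := ⟨_, rfl⟩
  obtain ⟨b, hb⟩ : ∃ b, b = 1 - Real.cos s := ⟨_, rfl⟩
  have ht' : Real.cos t = 1 - a := by linarith
  have hs' : Real.cos s = 1 - b := by linarith
  have hb0 : 3 / 2 ≤ b := by linarith
  have ha2 : a ≤ 2 := by linarith [Real.neg_one_le_cos t]
  have key : 2 * (a ^ 2 + a * b + b ^ 2) - (a + b) * (a ^ 2 + b ^ 2) ≤ 0 := by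
    obtain ⟨p, hp⟩ : ∃ p, p = a - 3 / 2 := ⟨_, rfl⟩
    obtain ⟨q, hq⟩ : ∃ q, q = b - 3 / 2 := ⟨_, rfl⟩
    have hp' : a = p + 3 / 2 := by linarith
    have hq' : b = q + 3 / 2 := by linarith
    have hq0 : 0 ≤ q := by linarith
    have hpq : q ≤ p := by linarith
    have hp0 : 0 ≤ p := by linarith
    rw [hp', hq']
    have := mul_nonneg hp0 hq0
    nlinarith [mul_nonneg hp0 (sq_nonneg p), mul_nonneg hq0 (sq_nonneg q),
      mul_nonneg hp0 (sq_nonneg q), mul_nonneg hq0 (sq_nonneg p)]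
  rw [ht', hs']
  nlinarith [mul_nonneg (by linarith : 0 ≤ a - b) (neg_nonneg.mpr key)]

/-- The product of the distances from the Fejér points to a point `-z` opposite to the arc grows
like the power of the modulus of its preimage outside the disc. -/
theorem abs_sum_log_norm_add_sub_le {z w w' u v : ℂ} (h : IsFibre z w w' u v)
    (hw : ‖w‖ = 1) (hw' : ‖w'‖ = 1) (hu : 1 < ‖u‖) (hv : ‖v‖ < 1) (hpsi : psi0 u = -z)
    {x : ℝ} (hx1 : 1 ≤ x) (hx2 : x ≤ 2) (hz : z = (-1 + I) * x) (n : ℕ) :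
    |∑ k, Real.log ‖z + psi0 (node n k)‖ - (n + 1) * Real.log ‖u‖| ≤ 1000 := by
  have hpi := Real.pi_pos
  set G : ℝ → ℝ := fun t => Real.log ‖z + psi0 (exp (t * I))‖ with hG
  have hzre : z.re < 0 := by rw [hz]; simp; linarith
  have hH : ∀ s : ℝ, Real.log ‖-z * circleMap 0 1 s - psiInv (circleMap 0 1 s)‖ = G (-s) := by
    intro s
    have hc : circleMap 0 1 s = exp (s * I) := by simp [circleMap]
    rw [hc, psiInv_eq (exp_ne_zero _), one_div, ← Complex.exp_neg, hG]
    simp only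
    rw [show -z * exp (s * I) - exp (s * I) * psi0 (exp (-(s * I))) =
      -(exp (s * I) * (z + psi0 (exp (-(s * I))))) by ring, norm_neg, norm_mul,
      norm_exp_ofReal_mul_I, one_mul, ofReal_neg, neg_mul]
  have hne : ∀ s : ℝ, z + psi0 (exp (s * I)) ≠ 0 := by
    intro s h0
    have := re_psi0_nonpos (norm_exp_ofReal_mul_I s)
    have h1 := congrArg re h0
    simp at h1
    linarith
  have hGc : Continuous fun s => G (-s) := by
    simp only [← hH]
    have hcm : Continuous fun s => psiInv (circleMap 0 1 s) :=
      continuousOn_psiInv.comp_continuous (continuous_circleMap 0 1) fun s => by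
        simp [circleMap]
    refine Continuous.log (by fun_prop) fun s h0 => ?_
    have h1 := hH s
    rw [norm_eq_zero] at h0
    rw [show circleMap 0 1 s = exp (s * I) by simp [circleMap],
      psiInv_eq (exp_ne_zero _), one_div, ← Complex.exp_neg] at h0
    have h2 := hne (-s)
    rw [ofReal_neg, neg_mul] at h2
    refine mul_ne_zero (exp_ne_zero (s * I)) h2 ?_
    linear_combination -h0
  have hGc' : Continuous G := by
    simpa [Function.comp_def] using hGc.comp continuous_neg
  have hper : Function.Periodic (fun s => G (-s)) (2 * π) := by
    intro s
    simp only [hG]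
    rw [show ((-(s + 2 * π) : ℝ) : ℂ) * I = ((-s : ℝ) : ℂ) * I - 2 * π * I by push_cast; ring,
      exp_periodic.sub_eq]
  have hint : ∫ t in (0)..π, (G t + G (-t)) = 2 * π * Real.log ‖u‖ := by
    have h1 := circleAverage_log_norm_psiInv h hw hw' hu hv hzre hpsi
    rw [circleAverage_def, smul_eq_mul, inv_mul_eq_iff_eq_mul₀ (by positivity)] at h1
    rw [← h1]
    simp only [hH]
    have h2 := hper.intervalIntegral_add_eq 0 (-π)
    rw [zero_add, show -π + 2 * π = π by ring] at h2
    rw [h2, ← intervalIntegral.integral_add_adjacent_intervals (b := 0)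
      (hGc.intervalIntegrable _ _) (hGc.intervalIntegrable _ _),
      intervalIntegral.integral_add (hGc'.intervalIntegrable _ _) (hGc.intervalIntegrable _ _)]
    congr 1
    rw [intervalIntegral.integral_comp_neg (fun t => G t)]
    simp
  -- The sum of the logarithms over the angles `±t` depends on `t` only through the radius, and
  -- increasingly; hence it is unimodal with peak at `2π/3`.
  set φ : ℝ → ℝ := fun y => Real.log (4 * (x + y) ^ 2 * (x ^ 2 + y ^ 2)) / 2 with hφ
  have hφmono : ∀ a b : ℝ, 0 ≤ a → a ≤ b → φ a ≤ φ b := by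
    intro a b ha hab
    simp only [hφ]
    have : 0 < 4 * (x + a) ^ 2 * (x ^ 2 + a ^ 2) := by positivity
    gcongr
  have hφ0 : ∀ a, 0 ≤ a → 0 ≤ φ a := by
    intro a ha
    refine div_nonneg (Real.log_nonneg ?_) zero_le_two
    have h1 : 1 ≤ (x + a) ^ 2 := by nlinarith
    have h2 : 1 ≤ x ^ 2 + a ^ 2 := by nlinarith
    nlinarith
  have hφB : ∀ a, 0 ≤ a → a ≤ 2 → φ a ≤ 256 := by
    intro a ha ha2
    have h1 : (x + a) ^ 2 ≤ 16 := by nlinarith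
    have h2 : x ^ 2 + a ^ 2 ≤ 8 := by nlinarith
    have h3 : 4 * (x + a) ^ 2 * (x ^ 2 + a ^ 2) ≤ 512 := by
      nlinarith [mul_le_mul h1 h2 (by positivity) (by norm_num)]
    have h4 : 0 < 4 * (x + a) ^ 2 * (x ^ 2 + a ^ 2) := by positivity
    have := Real.log_le_sub_one_of_pos h4
    simp only [hφ]
    linarith
  have hF : ∀ t ∈ Set.Icc 0 π, G t + G (-t) = φ (radius t) := by
    rintro t ⟨ht0, ht1⟩
    have hr := radius_nonneg ht0 ht1
    simp only [hG, hφ]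
    rw [← Real.log_mul (norm_ne_zero_iff.mpr (hne _)) (norm_ne_zero_iff.mpr (hne _)),
      psi0_exp_pos ht0 ht1, psi0_exp_neg ht0 ht1, hz]
    have e : 4 * (x + radius t) ^ 2 * (x ^ 2 + radius t ^ 2) =
        (‖(-1 + I) * (x : ℂ) + (-1 + I) * radius t‖ *
          ‖(-1 + I) * (x : ℂ) + (-1 - I) * radius t‖) ^ 2 := by
      rw [mul_pow, ← normSq_eq_norm_sq, ← normSq_eq_norm_sq, normSq_apply, normSq_apply]
      simp
      ring
    rw [e, Real.log_pow]
    push_cast; ring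
  have hquad := abs_sum_thetaUpper_sub_integral_le_of_unimodal (f := fun t => G t + G (-t))
    (a := 2 * π / 3) (B := 256) (by positivity) (by linarith) ?_ ?_ ?_ ?_ n
  · have hsum : ∑ k, Real.log ‖z + psi0 (node n k)‖ = _ := sum_theta_eq n G
    rw [hsum]
    rw [hint, show (n + 1) / (2 * π) * (2 * π * Real.log ‖u‖) = (n + 1) * Real.log ‖u‖ by
      field_simp] at hquad
    have hG0 := hF 0 ⟨le_rfl, hpi.le⟩
    rw [neg_zero, show radius 0 = 0 by simp [radius]] at hG0
    have b1 := hφ0 0 le_rfl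
    have b2 := hφB 0 le_rfl zero_le_two
    -- The quadrature error is at most `2 * 256`, and the angle `0` counted twice for even `n` costs
    -- at most `128`.
    rw [abs_le] at hquad ⊢
    constructor <;> split_ifs <;> linarith [hquad.1, hquad.2]
  · rintro s hs t ht hst
    have hs' : s ∈ Set.Icc 0 π := ⟨hs.1, by linarith [hs.2]⟩
    have ht' : t ∈ Set.Icc 0 π := ⟨ht.1, by linarith [ht.2]⟩
    simp only
    rw [hF s hs', hF t ht']
    exact hφmono _ _ (radius_nonneg hs'.1 hs'.2) (monotoneOn_radius hs ht hst)
  · rintro s hs t ht hst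
    have hs' : s ∈ Set.Icc 0 π := ⟨by linarith [hs.1], hs.2⟩
    have ht' : t ∈ Set.Icc 0 π := ⟨by linarith [ht.1], ht.2⟩
    simp only
    rw [hF s hs', hF t ht']
    exact hφmono _ _ (radius_nonneg ht'.1 ht'.2) (antitoneOn_radius hs ht hst)
  · intro t ht
    rw [hF t ht]
    exact hφ0 _ (radius_nonneg ht.1 ht.2)
  · intro t ht
    rw [hF t ht]
    exact hφB _ (radius_nonneg ht.1 ht.2) (radius_le_two ht.1 ht.2)

/-! ### Pairs of angles with the same image -/

/-- The cosine of half the sum of the two angles, at distance `2 * d`, with the same image on the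
upper segment. -/
noncomputable def midCos (d : ℝ) : ℝ := (1 - √(1 + 8 * Real.cos d ^ 2)) / (4 * Real.cos d)

/-- Half the sum of the two angles, at distance `2 * d`, with the same image on the upper
segment. -/
noncomputable def midAngle (d : ℝ) : ℝ := Real.arccos (midCos d)

section MidAngle

variable {d : ℝ}

theorem cos_ge_of_le_quarter (h0 : 0 ≤ d) (h1 : d ≤ 1 / 4) : 31 / 32 ≤ Real.cos d := by
  have := Real.one_sub_sq_div_two_le_cos (x := d)
  nlinarith

/-- The quadratic comes from eliminating the moduli of the two roots off the circle from the
coefficient relations of the quartic; the value `-1/2` belongs to the tip `d = 0`. -/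
theorem midCos_spec (h0 : 0 ≤ d) (h1 : d ≤ 1 / 4) :
    Real.cos d * (2 * midCos d ^ 2 - 1) = midCos d ∧
      -1 / 2 ≤ midCos d ∧ midCos d ≤ -49 / 100 := by
  have hC := cos_ge_of_le_quarter h0 h1
  have hC1 := Real.cos_le_one d
  set C := Real.cos d
  have hs : √(1 + 8 * C ^ 2) ^ 2 = 1 + 8 * C ^ 2 := Real.sq_sqrt (by positivity)
  have hs0 := Real.sqrt_nonneg (1 + 8 * C ^ 2)
  have hc : midCos d = (1 - √(1 + 8 * C ^ 2)) / (4 * C) := rfl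
  set s := √(1 + 8 * C ^ 2)
  refine ⟨?_, ?_, ?_⟩
  · rw [hc]
    field_simp
    nlinarith
  · rw [hc, le_div_iff₀ (by linarith)]
    nlinarith
  · rw [hc, div_le_iff₀ (by linarith)]
    nlinarith

theorem cos_midAngle (h0 : 0 ≤ d) (h1 : d ≤ 1 / 4) : Real.cos (midAngle d) = midCos d := by
  obtain ⟨-, h2, h3⟩ := midCos_spec h0 h1
  exact Real.cos_arccos (by linarith) (by linarith)

theorem midAngle_mem (h0 : 0 ≤ d) (h1 : d ≤ 1 / 4) :
    π / 2 ≤ midAngle d ∧ midAngle d ≤ 2 * π / 3 := by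
  obtain ⟨-, h2, h3⟩ := midCos_spec h0 h1
  have hpi := Real.pi_pos
  constructor
  · rw [← Real.arccos_zero]
    exact Real.arccos_le_arccos (by linarith)
  · rw [← Real.arccos_cos (by positivity : 0 ≤ 2 * π / 3) (by linarith), cos_two_pi_div_three]
    exact Real.arccos_le_arccos h2

theorem midAngle_zero : midAngle 0 = 2 * π / 3 := by
  have hpi := Real.pi_pos
  rw [← Real.arccos_cos (by positivity : 0 ≤ 2 * π / 3) (by linarith), cos_two_pi_div_three,
    midAngle, midCos, Real.cos_zero, show (1 : ℝ) + 8 * 1 ^ 2 = 3 ^ 2 by norm_num,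
    Real.sqrt_sq (by norm_num)]
  norm_num

theorem sin_midAngle_bounds (h0 : 0 ≤ d) (h1 : d ≤ 1 / 4) :
    86 / 100 ≤ Real.sin (midAngle d) ∧ Real.sin (midAngle d) ≤ 88 / 100 := by
  obtain ⟨h2, h3⟩ := midAngle_mem h0 h1
  obtain ⟨-, h4, h5⟩ := midCos_spec h0 h1
  have hpi := Real.pi_pos
  have hs : 0 ≤ Real.sin (midAngle d) :=
    Real.sin_nonneg_of_nonneg_of_le_pi (by linarith) (by linarith)
  have := Real.sin_sq_add_cos_sq (midAngle d)
  rw [cos_midAngle h0 h1] at this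
  constructor <;> nlinarith

theorem continuousOn_midAngle : ContinuousOn midAngle (Set.Icc 0 (1 / 4)) := by
  refine Real.continuous_arccos.comp_continuousOn ?_
  unfold midCos
  refine ContinuousOn.div (by fun_prop) (by fun_prop) fun d hd => ?_
  have := cos_ge_of_le_quarter hd.1 hd.2
  positivity

/-- An exact difference quotient: near the tip the two cofactors are about `1/4` and `3/2`, so
differences of `midCos` are about one sixth of differences of `cos`. -/
theorem midCos_sub {e : ℝ} (h0 : 0 ≤ d) (h1 : d ≤ 1 / 4) (h0' : 0 ≤ e) (h1' : e ≤ 1 / 4) :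
    (Real.cos d - Real.cos e) * ((1 - 2 * midCos d ^ 2) * (1 - 2 * midCos e ^ 2)) =
      (midCos e - midCos d) * (1 + 2 * midCos d * midCos e) := by
  have a := (midCos_spec h0 h1).1
  have b := (midCos_spec h0' h1').1
  linear_combination (2 * midCos e ^ 2 - 1) * a - (2 * midCos d ^ 2 - 1) * b

theorem midCos_mono {e : ℝ} (h0 : 0 ≤ d) (hde : d ≤ e) (h1 : e ≤ 1 / 4) :
    (Real.cos d - Real.cos e) / 6 ≤ midCos e - midCos d ∧
      midCos e - midCos d ≤ (Real.cos d - Real.cos e) / 5 := by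
  have h := midCos_sub h0 (hde.trans h1) (h0.trans hde) h1
  obtain ⟨-, a1, a2⟩ := midCos_spec h0 (hde.trans h1)
  obtain ⟨-, b1, b2⟩ := midCos_spec (h0.trans hde) h1
  have hC : 0 ≤ Real.cos d - Real.cos e := sub_nonneg.mpr
    (Real.cos_le_cos_of_nonneg_of_le_pi h0 (by linarith [Real.pi_gt_three]) hde)
  set p := midCos d
  set q := midCos e
  have e1 : 1 / 2 ≤ 1 - 2 * p ^ 2 ∧ 1 - 2 * p ^ 2 ≤ 52 / 100 := by constructor <;> nlinarith
  have e2 : 1 / 2 ≤ 1 - 2 * q ^ 2 ∧ 1 - 2 * q ^ 2 ≤ 52 / 100 := by constructor <;> nlinarith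
  have e3 : 148 / 100 ≤ 1 + 2 * p * q ∧ 1 + 2 * p * q ≤ 3 / 2 := by constructor <;> nlinarith
  have e4 : 1 / 4 ≤ (1 - 2 * p ^ 2) * (1 - 2 * q ^ 2) := by nlinarith
  have e5 : (1 - 2 * p ^ 2) * (1 - 2 * q ^ 2) ≤ 271 / 1000 := by nlinarith
  have hq : 0 ≤ q - p := by
    by_contra hneg
    push Not at hneg
    nlinarith [mul_nonneg hC (by linarith : 0 ≤ (1 - 2 * p ^ 2) * (1 - 2 * q ^ 2))]
  constructor <;> nlinarith

/-- The middle angle varies only quadratically in `d`. With `sq_div_le_sub_midAngle` this fixes the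
scale of the near-coincidences. -/
theorem midAngle_sub_le {e : ℝ} (h0 : 0 ≤ d) (hde : d ≤ e) (h1 : e ≤ 1 / 4) :
    0 ≤ midAngle d - midAngle e ∧ midAngle d - midAngle e ≤ (e ^ 2 - d ^ 2) / 4 := by
  have hpi := Real.pi_pos
  have hC : 0 ≤ Real.cos d - Real.cos e := sub_nonneg.mpr
    (Real.cos_le_cos_of_nonneg_of_le_pi h0 (by linarith [Real.pi_gt_three]) hde)
  obtain ⟨m1, m2⟩ := midCos_mono h0 hde h1
  have hmono : midAngle e ≤ midAngle d := Real.arccos_le_arccos (by linarith)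
  obtain ⟨a1, a2⟩ := midAngle_mem h0 (hde.trans h1)
  obtain ⟨b1, b2⟩ := midAngle_mem (h0.trans hde) h1
  refine ⟨by linarith, ?_⟩
  have c1 : Real.cos d - Real.cos e ≤ (e ^ 2 - d ^ 2) / 2 := by
    rw [Real.cos_sub_cos, show (d - e) / 2 = -((e - d) / 2) by ring, Real.sin_neg]
    have s1 := Real.sin_le (x := (d + e) / 2) (by linarith)
    have s2 := Real.sin_le (x := (e - d) / 2) (by linarith)
    have s3 : 0 ≤ Real.sin ((e - d) / 2) := Real.sin_nonneg_of_nonneg_of_le_pi (by linarith)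
      (by linarith [Real.pi_gt_three])
    nlinarith [mul_le_mul s1 s2 s3 (by linarith)]
  have c2 : 2 / π * (midAngle d - midAngle e) * (2 / 3) ≤ midCos e - midCos d := by
    rw [← cos_midAngle h0 (hde.trans h1), ← cos_midAngle (h0.trans hde) h1, Real.cos_sub_cos,
      show (midAngle e - midAngle d) / 2 = -((midAngle d - midAngle e) / 2) by ring, Real.sin_neg,
      ← Real.sin_pi_sub ((midAngle e + midAngle d) / 2)]
    have s1 := Real.mul_le_sin (x := π - (midAngle e + midAngle d) / 2) (by linarith) (by linarith)
    have s2 := Real.mul_le_sin (x := (midAngle d - midAngle e) / 2) (by linarith) (by linarith)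
    have s3 : 2 / 3 ≤ 2 / π * (π - (midAngle e + midAngle d) / 2) := by
      rw [div_mul_eq_mul_div, le_div_iff₀ hpi]; linarith
    have s4 : 0 ≤ 2 / π * ((midAngle d - midAngle e) / 2) :=
      mul_nonneg (by positivity) (by linarith)
    nlinarith [mul_le_mul (s3.trans s1) s2 s4 (by linarith)]
  have c3 : 62 / 100 ≤ 2 / π := by
    rw [le_div_iff₀ hpi]; nlinarith [Real.pi_lt_d2]
  have c4 : 62 / 100 * (midAngle d - midAngle e) ≤ 2 / π * (midAngle d - midAngle e) :=
    mul_le_mul_of_nonneg_right c3 (by linarith)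
  linarith

theorem sq_div_le_sub_midAngle (h0 : 0 ≤ d) (h1 : d ≤ 1 / 4) :
    d ^ 2 / 30 ≤ 2 * π / 3 - midAngle d := by
  obtain ⟨m1, -⟩ := midCos_mono le_rfl h0 h1
  have hpi := Real.pi_pos
  have hq := Real.cos_le_one_sub_mul_cos_sq (x := d)
    (by rw [abs_of_nonneg h0]; linarith [Real.pi_gt_three])
  have hp : 1 / 5 ≤ 2 / π ^ 2 := by
    rw [div_le_div_iff₀ (by norm_num) (by positivity)]
    nlinarith [Real.pi_lt_d2]
  have h2 : 1 / 5 * d ^ 2 ≤ 2 / π ^ 2 * d ^ 2 := by gcongr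
  have h3 : midCos d - midCos 0 ≤ 2 * π / 3 - midAngle d := by
    obtain ⟨a1, a2⟩ := midAngle_mem h0 h1
    rw [← cos_midAngle h0 h1, ← cos_midAngle le_rfl (by norm_num), midAngle_zero, Real.cos_sub_cos,
      show (midAngle d - 2 * π / 3) / 2 = -((2 * π / 3 - midAngle d) / 2) by ring, Real.sin_neg]
    have s1 := Real.sin_le (x := (2 * π / 3 - midAngle d) / 2) (by linarith)
    have s2 := Real.sin_le_one ((midAngle d + 2 * π / 3) / 2)
    have s3 : 0 ≤ Real.sin ((2 * π / 3 - midAngle d) / 2) :=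
      Real.sin_nonneg_of_nonneg_of_le_pi (by linarith) (by linarith)
    nlinarith
  rw [Real.cos_zero] at m1
  linarith

/-- The relations between the two angles and the modulus of the exterior preimage. -/
theorem midAngle_relations (h0 : 0 ≤ d) (h1 : d ≤ 1 / 4) :
    ∃ E : ℝ, 16 / 10 ≤ E ∧
      Real.cos (midAngle d) * Real.cos d + Real.sin (midAngle d) * ((E + 1 / E) / 2) = 1 ∧
      Real.sin (midAngle d) * Real.cos d + Real.cos (midAngle d) * ((E + 1 / E) / 2) = 0 := by
  obtain ⟨h2, h3, h4⟩ := midCos_spec h0 h1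
  obtain ⟨h5, h6⟩ := sin_midAngle_bounds h0 h1
  have h7 := Real.sin_sq_add_cos_sq (midAngle d)
  rw [cos_midAngle h0 h1] at *
  set c := midCos d
  set s := Real.sin (midAngle d)
  have hD : 0 < 1 - 2 * c ^ 2 := by nlinarith
  set K := s / (1 - 2 * c ^ 2) with hK
  have hK1 : 16 / 10 ≤ K := by
    rw [hK, le_div_iff₀ hD]; nlinarith
  have hsq : √(K ^ 2 - 1) ^ 2 = K ^ 2 - 1 := Real.sq_sqrt (by nlinarith)
  have hs0 := Real.sqrt_nonneg (K ^ 2 - 1)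
  have hE : K + √(K ^ 2 - 1) ≠ 0 := by positivity
  have hKE : (K + √(K ^ 2 - 1) + 1 / (K + √(K ^ 2 - 1))) / 2 = K := by
    field_simp
    nlinarith
  have hKD : K * (1 - 2 * c ^ 2) = s := by rw [hK]; field_simp
  refine ⟨K + √(K ^ 2 - 1), by linarith, ?_, ?_⟩
  · rw [hKE]
    refine mul_right_cancel₀ hD.ne' ?_
    linear_combination -c * h2 + s * hKD + h7
  · rw [hKE]
    refine mul_right_cancel₀ hD.ne' ?_
    linear_combination -s * h2 + c * hKD

end MidAngle

/-! ### The outer angle as parameter, and the explicit fibre -/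

/-- The larger of the two angles, at distance `2 * d`, with the same image on the upper segment. -/
noncomputable def outerAngle (d : ℝ) : ℝ := midAngle d + d

section Fibre

variable {d : ℝ}

theorem outerAngle_sub_le {e : ℝ} (h0 : 0 ≤ d) (hde : d ≤ e) (h1 : e ≤ 1 / 4) :
    (e - d) * (7 / 8) ≤ outerAngle e - outerAngle d ∧ outerAngle e - outerAngle d ≤ e - d := by
  obtain ⟨h2, h3⟩ := midAngle_sub_le h0 hde h1
  unfold outerAngle
  constructor <;> nlinarith

theorem outerAngle_zero : outerAngle 0 = 2 * π / 3 := by rw [outerAngle, midAngle_zero, add_zero]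

theorem outerAngle_bounds (h0 : 0 ≤ d) (h1 : d ≤ 1 / 4) :
    2 * π / 3 + d * (7 / 8) ≤ outerAngle d ∧ outerAngle d ≤ 2 * π / 3 + d := by
  have := outerAngle_sub_le le_rfl h0 h1
  rw [outerAngle_zero] at this
  constructor <;> linarith [this.1, this.2]

theorem outerAngle_mem (h0 : 0 ≤ d) (h1 : d ≤ 1 / 4) : 0 ≤ outerAngle d ∧ outerAngle d < π := by
  have := outerAngle_bounds h0 h1
  have hpi := Real.pi_gt_three
  constructor <;> linarith [this.1, this.2]

theorem radius_outerAngle_pow_four (h0 : 0 ≤ d) (h1 : d ≤ 1 / 4) :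
    1 ≤ radius (outerAngle d) ∧ 27 / 4 - 27 * d ^ 2 ≤ radius (outerAngle d) ^ 4 ∧
      radius (outerAngle d) ^ 4 ≤ 27 / 4 := by
  obtain ⟨h2, h3⟩ := outerAngle_mem h0 h1
  obtain ⟨h4, h5⟩ := outerAngle_bounds h0 h1
  have hr := radius_pow_four h2 h3.le
  have hlip : |Real.cos (outerAngle d) - Real.cos (2 * π / 3)| ≤ d := by
    have := Real.abs_cos_sub_cos_le (outerAngle d) (2 * π / 3)
    refine this.trans ?_
    rw [abs_le]; constructor <;> linarith
  rw [cos_two_pi_div_three, abs_le] at hlip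
  set c := Real.cos (outerAngle d)
  have hc := Real.neg_one_le_cos (outerAngle d)
  -- The double zero at the tip makes the radius stationary there; the cofactor is at most `27` on
  -- `[-1, 1]`.
  have hpoly : 4 * (1 - c) ^ 3 * (1 + c) = 27 / 4 - (c + 1 / 2) ^ 2 * (4 * c ^ 2 - 12 * c + 11) := by
    ring
  have hb1 : 0 ≤ 4 * c ^ 2 - 12 * c + 11 := by nlinarith [sq_nonneg (2 * c - 3)]
  have hb2 : 4 * c ^ 2 - 12 * c + 11 ≤ 27 := by nlinarith
  have hb3 : (c + 1 / 2) ^ 2 ≤ d ^ 2 := by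
    rw [sq_le_sq, abs_of_nonneg h0, abs_le]; constructor <;> linarith
  have hb4 : (c + 1 / 2) ^ 2 * (4 * c ^ 2 - 12 * c + 11) ≤ 27 * d ^ 2 := by
    nlinarith [mul_le_mul hb3 hb2 hb1 (sq_nonneg d)]
  have hb5 : 0 ≤ (c + 1 / 2) ^ 2 * (4 * c ^ 2 - 12 * c + 11) := mul_nonneg (sq_nonneg _) hb1
  refine ⟨?_, by linarith, by linarith⟩
  refine le_of_pow_le_pow_left₀ (n := 4) (by norm_num) (radius_nonneg h2 h3.le) ?_
  rw [one_pow]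
  nlinarith

/-- Points near the tip are quadratically close. This gains the factor `d` which makes the
fundamental polynomials large. -/
theorem abs_radius_sub_le {e : ℝ} (h0 : 0 ≤ d) (hde : d ≤ e) (h1 : e ≤ 1 / 4) :
    |radius (outerAngle d) - radius (outerAngle e)| ≤ 27 * e ^ 2 := by
  obtain ⟨a1, a2, a3⟩ := radius_outerAngle_pow_four h0 (hde.trans h1)
  obtain ⟨b1, b2, b3⟩ := radius_outerAngle_pow_four (h0.trans hde) h1
  have hd2 : d ^ 2 ≤ e ^ 2 := by gcongr
  set p := radius (outerAngle d)
  set q := radius (outerAngle e)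
  have h4 : p ^ 4 - q ^ 4 = (p - q) * ((p + q) * (p ^ 2 + q ^ 2)) := by ring
  have h5 : 1 ≤ (p + q) * (p ^ 2 + q ^ 2) := by nlinarith
  have h6 : |p - q| * 1 ≤ |p ^ 4 - q ^ 4| := by
    rw [h4, abs_mul]
    gcongr
    exact h5.trans (le_abs_self _)
  rw [mul_one] at h6
  refine h6.trans ?_
  rw [abs_le]; constructor <;> linarith

/-- The fibre through the point of the upper segment with parameter `d`. -/
theorem exists_fibre (h0 : 0 ≤ d) (h1 : d ≤ 1 / 4) :
    ∃ u v : ℂ, ∃ E : ℝ, 16 / 10 ≤ E ∧ ‖u‖ = E ∧ ‖v‖ = E⁻¹ ∧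
      psi0 u = -psi0 (exp (outerAngle d * I)) ∧
      IsFibre (psi0 (exp (outerAngle d * I))) (exp (outerAngle d * I))
        (exp ((midAngle d - d : ℝ) * I)) u v := by
  obtain ⟨E, hE, hr1, hr2⟩ := midAngle_relations h0 h1
  obtain ⟨ht0, htpi⟩ := outerAngle_mem h0 h1
  obtain ⟨hrad, -, -⟩ := radius_outerAngle_pow_four h0 h1
  obtain ⟨hc0, hc1, hc2⟩ := midCos_spec h0 h1
  obtain ⟨hs1, -⟩ := sin_midAngle_bounds h0 h1
  have hdd := Real.sin_sq_add_cos_sq d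
  have hcm := cos_midAngle h0 h1
  obtain ⟨F, hF⟩ : ∃ F : ℝ, F = E⁻¹ := ⟨_, rfl⟩
  have hF0 : 0 < F := by rw [hF]; exact inv_pos.mpr (by linarith)
  have hF1 : F < 1 := by rw [hF]; exact inv_lt_one_of_one_lt₀ (by linarith)
  have hEF : (E : ℂ) * F = 1 := by
    rw [hF]; exact_mod_cast mul_inv_cancel₀ (by linarith : E ≠ 0)
  rw [one_div, ← hF] at hr1 hr2
  set β := midAngle d with hβ
  have ha : exp (β * I) = Real.cos β + Real.sin β * I := by
    rw [exp_mul_I, ofReal_cos, ofReal_sin]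
  have hab : exp (-(β * I)) = Real.cos β - Real.sin β * I := by
    rw [← neg_mul, exp_mul_I, Complex.cos_neg, Complex.sin_neg, ofReal_cos, ofReal_sin]; ring
  set b := exp (-(β * I)) with hb
  set a := exp (β * I) with ha'
  have hba : a * b = 1 := by rw [ha', hb, ← Complex.exp_add]; simp
  have hw : exp (outerAngle d * I) = a * (Real.cos d + Real.sin d * I) := by
    rw [outerAngle, ofReal_add, add_mul, Complex.exp_add, exp_mul_I (d : ℂ), ofReal_cos,
      ofReal_sin]
  have hw' : exp ((β - d : ℝ) * I) = a * (Real.cos d - Real.sin d * I) := by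
    rw [ofReal_sub, sub_mul, sub_eq_add_neg, Complex.exp_add, ← neg_mul, exp_mul_I (-d : ℂ),
      Complex.cos_neg, Complex.sin_neg, ofReal_cos, ofReal_sin]
    ring
  have hnb : ‖b‖ = 1 := by rw [hb, ← neg_mul, ← ofReal_neg, norm_exp_ofReal_mul_I]
  set w := exp (outerAngle d * I) with hwdef
  have hw0 : w ≠ 0 := exp_ne_zero _
  have hw1 : w + 1 ≠ 0 := by
    intro h
    have h2 : w.im = 0 := by rw [show w = -1 by linear_combination h]; simp
    rw [hwdef, exp_ofReal_mul_I_im] at h2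
    have : 0 < Real.sin (outerAngle d) := Real.sin_pos_of_pos_of_lt_pi
      (by linarith [(outerAngle_bounds h0 h1).1, Real.pi_gt_three]) htpi
    linarith
  have C1 : (Real.cos β : ℂ) * Real.cos d + Real.sin β * ((E + F) / 2) = 1 := by
    exact_mod_cast hr1
  have C2 : (Real.sin β : ℂ) * Real.cos d + Real.cos β * ((E + F) / 2) = 0 := by
    exact_mod_cast hr2
  have hdd' : (Real.sin d : ℂ) ^ 2 + (Real.cos d : ℂ) ^ 2 = 1 := by exact_mod_cast hdd
  have R1 : a * Real.cos d + I * ((E + F) / 2) * b = 1 := by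
    rw [ha, hab]
    linear_combination C1 + I * C2 - (Real.sin β * ((E + F) / 2) : ℂ) * I_sq
  have R2 : b * Real.cos d - I * ((E + F) / 2) * a = 1 := by
    rw [ha, hab]
    linear_combination C1 - I * C2 - (Real.sin β * ((E + F) / 2) : ℂ) * I_sq
  set w' := exp ((β - d : ℝ) * I) with hw'def
  -- The quartic is `s⁴ - 2s³ - z²s² + 2s - 1`. The elementary symmetric functions `2`, `-2`, `-1`
  -- are checked directly; the middle one is obtained from the fact that `w` is a root.
  have hsum : w + w' + (I * E * b + I * F * b) = 2 := by
    rw [hw, hw']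
    linear_combination 2 * R1
  have hpww : w * w' = a ^ 2 := by
    rw [hw, hw']
    linear_combination a ^ 2 * hdd' - a ^ 2 * (Real.sin d : ℂ) ^ 2 * I_sq
  have hpuv : (I * E * b) * (I * F * b) = -b ^ 2 := by
    linear_combination (I ^ 2 * b ^ 2) * hEF + b ^ 2 * I_sq
  have hthree : w * w' * (I * E * b + I * F * b) +
      (w + w') * ((I * E * b) * (I * F * b)) = -2 := by
    rw [hpww, hpuv, hw, hw']
    linear_combination -2 * R2 + (I * (E + F) * a - 2 * b * Real.cos d) * hba
  have hfour : w * w' * ((I * E * b) * (I * F * b)) = -1 := by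
    rw [hpww, hpuv]
    linear_combination (-a * b - 1) * hba
  have hsq := psi0_sq hw0 hw1
  rw [eq_div_iff (pow_ne_zero 2 hw0)] at hsq
  have hfib : IsFibre (psi0 w) w w' (I * E * b) (I * F * b) := by
    have hY : psi0 w ^ 2 = -(w * w' + (w + w') * (I * E * b + I * F * b) +
        (I * E * b) * (I * F * b)) := by
      refine mul_right_cancel₀ (pow_ne_zero 2 hw0) ?_
      linear_combination hsq + w ^ 3 * hsum + w * hthree - hfour
    intro s
    rw [hY]
    linear_combination s ^ 3 * hsum + s * hthree - hfour
  -- This has real part `(E - F) sin β > 0` and imaginary part `(E + F) cos β < 0`, the signs that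
  -- decide between `z` and `-z`.
  have hinv : (I * E * b) - 1 / (I * E * b) = I * E * b + I * F * a := by
    have h2 : (I * E * b) * (I * F * a) = -1 := by
        linear_combination (I ^ 2 * (a * b)) * hEF + I ^ 2 * hba + I_sq
    have h3 : I * E * b ≠ 0 := by
      intro h; rw [h] at h2; simp at h2
    have h4 : 1 / (I * E * b) = -(I * F * a) := by
      rw [div_eq_iff h3]; linear_combination h2
    rw [h4]; ring
  have hnu : ‖I * E * b‖ = E := by
    rw [norm_mul, norm_mul, hnb, norm_I, norm_real, Real.norm_of_nonneg (by linarith)]; ring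
  refine ⟨I * E * b, I * F * b, E, hE, hnu, ?_, ?_, hfib⟩
  · rw [norm_mul, norm_mul, hnb, norm_I, norm_real, Real.norm_of_nonneg hF0.le, hF]
    ring
  · refine psi0_eq_neg_of_isFibre hfib (x := radius (outerAngle d)) (by linarith)
      (psi0_exp_pos ht0 htpi.le) (by rw [hnu]; linarith) ?_ ?_
    · rw [hinv, ha, hab]
      simp [-ofReal_cos, -ofReal_sin]
      nlinarith
    · rw [hinv, ha, hab]
      simp [-ofReal_cos, -ofReal_sin]
      rw [hcm]
      nlinarith

end Fibre

/-! ### Size of the node polynomial and of its derivative at the nodes -/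

theorem psi0_outerAngle {d : ℝ} (h0 : 0 ≤ d) (h1 : d ≤ 1 / 4) :
    psi0 (exp (outerAngle d * I)) = (-1 + I) * radius (outerAngle d) :=
  psi0_exp_pos (outerAngle_mem h0 h1).1 (outerAngle_mem h0 h1).2.le

theorem psi0_outerAngle_re_neg {d : ℝ} (h0 : 0 ≤ d) (h1 : d ≤ 1 / 4) :
    (psi0 (exp (outerAngle d * I))).re < 0 := by
  rw [psi0_outerAngle h0 h1]
  have := (radius_outerAngle_pow_four h0 h1).1
  simp
  linarith

theorem prod_norm_add_bounds {d E : ℝ} (h0 : 0 ≤ d) (h1 : d ≤ 1 / 4) {w' u v : ℂ}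
    (hw' : ‖w'‖ = 1) (hE : 16 / 10 ≤ E) (hu : ‖u‖ = E) (hv : ‖v‖ = E⁻¹)
    (hpsi : psi0 u = -psi0 (exp (outerAngle d * I)))
    (hf : IsFibre (psi0 (exp (outerAngle d * I))) (exp (outerAngle d * I)) w' u v) (n : ℕ) :
    Real.exp (-1000) * E ^ (n + 1) ≤
        ∏ j, ‖psi0 (exp (outerAngle d * I)) + psi0 (node n j)‖ ∧
      ∏ j, ‖psi0 (exp (outerAngle d * I)) + psi0 (node n j)‖ ≤
        Real.exp 1000 * E ^ (n + 1) := by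
  obtain ⟨hr1, -, -⟩ := radius_outerAngle_pow_four h0 h1
  obtain ⟨ht0, ht1⟩ := outerAngle_mem h0 h1
  have hneg := psi0_outerAngle_re_neg h0 h1
  have h := abs_sum_log_norm_add_sub_le hf (norm_exp_ofReal_mul_I _) hw' (by rw [hu]; linarith)
    (by rw [hv]; exact inv_lt_one_of_one_lt₀ (by linarith)) hpsi hr1
    (radius_le_two ht0 ht1.le) (psi0_outerAngle h0 h1) n
  set z := psi0 (exp (outerAngle d * I))
  have hpos : ∀ j, 0 < ‖z + psi0 (node n j)‖ := by
    intro j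
    rw [norm_pos_iff]
    intro h0
    have := re_psi0_nonpos (norm_node n j)
    have h1 := congrArg re h0
    simp at h1
    linarith
  rw [← Real.log_prod (fun j _ => (hpos j).ne'), hu] at h
  have hP : 0 < ∏ j, ‖z + psi0 (node n j)‖ := Finset.prod_pos fun j _ => hpos j
  have hE' : Real.exp ((n + 1) * Real.log E) = E ^ (n + 1) := by
    rw [show ((n : ℝ) + 1) = ((n + 1 : ℕ) : ℝ) by push_cast; rfl, Real.exp_nat_mul,
      Real.exp_log (by linarith)]
  rw [abs_le] at h
  rw [← hE', ← Real.exp_add, ← Real.exp_add]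
  constructor
  · rw [← Real.le_log_iff_exp_le hP]; linarith [h.1]
  · rw [← Real.log_le_iff_le_exp hP]; linarith [h.2]

theorem abs_im_le_norm_sub_nodeSign (y : ℂ) (n : ℕ) : |y.im| ≤ ‖y - nodeSign n‖ := by
  have : (y - nodeSign n).im = y.im := by unfold nodeSign; split_ifs <;> simp
  rw [← this]
  exact abs_im_le_norm _

/-- `nodeSign n` is real, so the imaginary part alone gives the bound. -/
theorem norm_exp_pow_sub_nodeSign_ge (t : ℝ) (n : ℕ) :
    |Real.sin ((n + 1) * t)| ≤ ‖exp (t * I) ^ (n + 1) - nodeSign n‖ := by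
  refine le_trans (le_of_eq ?_) (abs_im_le_norm_sub_nodeSign _ n)
  rw [← exp_ofReal_mul_I_im, ← Complex.exp_nat_mul]
  congr 3
  push_cast; ring

/-- At the special point, the node polynomial has its full size. -/
theorem prod_norm_sub_ge {d : ℝ} (h0 : 0 ≤ d) (h1 : d ≤ 1 / 4) {n : ℕ}
    (hd : (n + 1) * d = π / 2) (hcos : 1 / 4 ≤ |Real.cos ((n + 1) * midAngle d)|) :
    Real.exp (-1000) / 120 ≤ ∏ j, ‖psi0 (exp (outerAngle d * I)) - psi0 (node n j)‖ := by
  obtain ⟨u, v, E, hE, hu, hv, hpsi, hf⟩ := exists_fibre h0 h1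
  have hD := (prod_norm_add_bounds h0 h1 (norm_exp_ofReal_mul_I _) hE hu hv hpsi hf n).2
  have hprod := prod_norm_sub_mul_prod_norm_add (n := n) hf
  set z := psi0 (exp (outerAngle d * I))
  have hEN : 1 ≤ E ^ n := one_le_pow₀ (by linarith)
  have hE0 : 0 < E ^ (n + 1) := by positivity
  have hw : 1 / 16 ≤ ‖exp (outerAngle d * I) ^ (n + 1) - nodeSign n‖ *
      ‖exp ((midAngle d - d : ℝ) * I) ^ (n + 1) - nodeSign n‖ := by
    refine le_trans ?_ (mul_le_mul (norm_exp_pow_sub_nodeSign_ge _ n)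
      (norm_exp_pow_sub_nodeSign_ge _ n) (abs_nonneg _) (norm_nonneg _))
    -- The choice `N d = π/2` turns both sines into `± cos (N β)`.
    rw [outerAngle, mul_add, mul_sub, hd, Real.sin_add_pi_div_two, Real.sin_sub_pi_div_two,
      abs_neg]
    nlinarith
  have hU : 3 / 8 * E ^ (n + 1) ≤ ‖u ^ (n + 1) - nodeSign n‖ := by
    have := norm_sub_norm_le (u ^ (n + 1)) (nodeSign n)
    rw [norm_pow, hu, norm_nodeSign] at this
    rw [pow_succ] at *
    nlinarith
  have hV : 3 / 8 ≤ ‖v ^ (n + 1) - nodeSign n‖ := by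
    have := norm_sub_norm_le (nodeSign n) (v ^ (n + 1))
    rw [norm_pow, hv, norm_nodeSign, norm_sub_rev] at this
    have h2 : E⁻¹ ^ (n + 1) ≤ 5 / 8 := by
      refine (pow_le_of_le_one (by positivity) (inv_le_one_of_one_le₀ (by linarith))
        n.succ_ne_zero).trans ?_
      rw [inv_le_comm₀ (by linarith) (by norm_num)]
      linarith
    linarith
  have hP0 : 0 ≤ ∏ j, ‖z - psi0 (node n j)‖ := Finset.prod_nonneg fun _ _ => norm_nonneg _
  set A := ∏ j, ‖z - psi0 (node n j)‖
  have h2 : 1 / 16 * (3 / 8 * E ^ (n + 1)) * (3 / 8) ≤ A * (Real.exp 1000 * E ^ (n + 1)) := by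
    calc _ ≤ _ := mul_le_mul (mul_le_mul hw hU (by positivity) (by positivity)) hV (by norm_num)
          (by positivity)
      _ = _ := hprod.symm
      _ ≤ _ := mul_le_mul_of_nonneg_left hD hP0
  have h3 : 1 / 120 ≤ A * Real.exp 1000 := by
    refine le_of_mul_le_mul_right ?_ hE0
    nlinarith
  rw [Real.exp_neg, inv_eq_one_div, div_div, div_le_iff₀ (by positivity)]
  linarith

/-- The two unimodular powers have product `e^{2iNβ}`. One being `ε`, the other is `ε e^{2iNβ}`, at
distance `|e^{iNβ} - e^{-iNβ}|` from `ε`. -/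
theorem norm_conj_exp_pow_sub {β d : ℝ} {n : ℕ}
    (hw : exp ((β + d : ℝ) * I) ^ (n + 1) = nodeSign n) :
    ‖exp ((β - d : ℝ) * I) ^ (n + 1) - nodeSign n‖ = 2 * |Real.sin ((n + 1) * β)| := by
  have he : nodeSign n * nodeSign n = 1 := by rw [← sq, nodeSign_sq]
  set y := exp (((n + 1) * β : ℝ) * I) with hy
  have h1 : exp ((β - d : ℝ) * I) ^ (n + 1) * exp ((β + d : ℝ) * I) ^ (n + 1) = y * y := by
    rw [← mul_pow, ← Complex.exp_add, hy, ← Complex.exp_add, ← Complex.exp_nat_mul]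
    congr 1; push_cast; ring
  rw [hw] at h1
  have h2 : exp ((β - d : ℝ) * I) ^ (n + 1) - nodeSign n =
      nodeSign n * y * (y - exp (-(((n + 1) * β : ℝ) * I))) := by
    have h3 : y * exp (-(((n + 1) * β : ℝ) * I)) = 1 := by
      rw [hy, ← Complex.exp_add]; simp
    linear_combination nodeSign n * h1 - exp ((β - d : ℝ) * I) ^ (n + 1) * he + nodeSign n * h3
  have h4 : y - exp (-(((n + 1) * β : ℝ) * I)) = 2 * Real.sin ((n + 1) * β) * I := by
    rw [hy, ofReal_sin, Complex.sin, ← neg_mul]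
    linear_combination
      (exp (((n + 1) * β : ℝ) * I) - exp (-((n + 1) * β : ℝ) * I)) * I_sq
  rw [h2, h4, norm_mul, norm_mul, norm_nodeSign, hy, norm_exp_ofReal_mul_I, norm_mul, norm_mul,
    norm_I, norm_real, Real.norm_eq_abs, RCLike.norm_ofNat]
  ring

/-- The derivative of the node polynomial is small where two images nearly coincide. -/
theorem prod_erase_norm_sub_le {d : ℝ} (h0 : 0 ≤ d) (h1 : d ≤ 1 / 4) {n : ℕ} {k : Fin (n + 1)}
    (hk : theta n k = outerAngle d) :
    (∏ j ∈ Finset.univ.erase k, ‖psi0 (node n k) - psi0 (node n j)‖) * d ≤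
      300 * Real.exp 1000 * ((n + 1) * |Real.sin ((n + 1) * midAngle d)|) := by
  obtain ⟨u, v, E, hE, hu, hv, hpsi, hf⟩ := exists_fibre h0 h1
  have hD := (prod_norm_add_bounds h0 h1 (norm_exp_ofReal_mul_I _) hE hu hv hpsi hf n).1
  have hnode : exp (outerAngle d * I) = node n k := by rw [node, hk]
  have hsin := norm_conj_exp_pow_sub (β := midAngle d) (d := d) (n := n)
    (by rw [← node_pow n k, ← hnode, outerAngle])
  rw [hnode] at hf hD hpsi
  have hprod := prod_erase_norm_sub_mul_prod_norm_add k hf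
  rw [hsin] at hprod
  set A := ∏ j ∈ Finset.univ.erase k, ‖psi0 (node n k) - psi0 (node n j)‖
  have hA : 0 ≤ A := Finset.prod_nonneg fun _ _ => norm_nonneg _
  have hE0 : 0 < E ^ (n + 1) := by positivity
  have hr := radius_outerAngle_pow_four h0 h1
  have hr2 := radius_le_two (outerAngle_mem h0 h1).1 (outerAngle_mem h0 h1).2.le
  have hz : ‖psi0 (node n k) + psi0 (node n k)‖ ≤ 8 := by
    rw [← hnode, psi0_outerAngle h0 h1, ← two_mul]
    have h2 : ‖(-1 + I : ℂ)‖ ≤ 2 := (norm_add_le _ _).trans (by simp; norm_num)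
    rw [norm_mul, norm_mul, norm_real, Real.norm_of_nonneg (by linarith), RCLike.norm_ofNat]
    nlinarith [norm_nonneg (-1 + I : ℂ)]
  -- The lower bound holds for the full product; the extra factor at `k` is `2 ‖z_k‖ ≤ 8`.
  rw [← Finset.mul_prod_erase Finset.univ _ (Finset.mem_univ k)] at hD
  set B := ∏ j ∈ Finset.univ.erase k, ‖psi0 (node n k) + psi0 (node n j)‖
  have hB : 0 ≤ B := Finset.prod_nonneg fun _ _ => norm_nonneg _
  have hB2 : Real.exp (-1000) * E ^ (n + 1) / 8 ≤ B := by
    have := hD.trans (mul_le_mul_of_nonneg_right hz hB)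
    linarith
  have hw' : d ≤ ‖exp ((midAngle d - d : ℝ) * I) - node n k‖ := by
    rw [← hnode, outerAngle]
    have e1 : exp ((midAngle d - d : ℝ) * I) - exp ((midAngle d + d : ℝ) * I) =
        exp (midAngle d * I) * (-2 * Real.sin d * I) := by
      rw [ofReal_sub, ofReal_add, sub_mul, add_mul, Complex.exp_add,
        sub_eq_add_neg (midAngle d * I : ℂ), Complex.exp_add, ofReal_sin, Complex.sin, ← neg_mul]
      linear_combination exp (midAngle d * I) * (exp (-d * I) - exp (d * I)) * I_sq
    rw [e1, norm_mul, norm_exp_ofReal_mul_I, one_mul, norm_mul, norm_mul, norm_I, norm_real,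
      norm_neg, RCLike.norm_ofNat, Real.norm_eq_abs, mul_one]
    have h3 := Real.mul_le_sin h0 (by linarith [Real.pi_gt_three])
    have h4 : 1 / 2 ≤ 2 / π := by
      rw [div_le_div_iff₀ (by norm_num) Real.pi_pos]; linarith [Real.pi_lt_four]
    have h5 : 1 / 2 * d ≤ 2 / π * d := by gcongr
    linarith [le_abs_self (Real.sin d)]
  have hun : 6 / 10 ≤ ‖u - node n k‖ := by
    have := norm_sub_norm_le u (node n k)
    rw [hu, norm_node] at this
    linarith
  have hEinv : E⁻¹ ≤ 5 / 8 := by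
    rw [inv_le_comm₀ (by linarith) (by norm_num)]; linarith
  have hvn : 3 / 8 ≤ ‖v - node n k‖ := by
    have := norm_sub_norm_le (node n k) v
    rw [hv, norm_node, norm_sub_rev] at this
    linarith
  have hU : ‖u ^ (n + 1) - nodeSign n‖ ≤ 2 * E ^ (n + 1) := by
    refine (norm_sub_le _ _).trans ?_
    rw [norm_pow, hu, norm_nodeSign]
    linarith [one_le_pow₀ (by linarith : 1 ≤ E) (n := n + 1)]
  have hV : ‖v ^ (n + 1) - nodeSign n‖ ≤ 2 := by
    refine (norm_sub_le _ _).trans ?_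
    rw [norm_pow, hv, norm_nodeSign]
    linarith [pow_le_one₀ (n := n + 1) (by positivity : 0 ≤ E⁻¹) (by linarith)]
  set S := |Real.sin ((n + 1) * midAngle d)|
  have hS : 0 ≤ S := abs_nonneg _
  have key : A * (Real.exp (-1000) * E ^ (n + 1) / 8) * (d * (6 / 10) * (3 / 8)) ≤
      (n + 1) * (2 * S * (2 * E ^ (n + 1)) * 2) := by
    calc _ ≤ A * B * (‖exp ((midAngle d - d : ℝ) * I) - node n k‖ * ‖u - node n k‖ *
          ‖v - node n k‖) := by gcongr
      _ = _ := hprod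
      _ ≤ _ := by gcongr
  have key2 : A * d * Real.exp (-1000) ≤ 300 * ((n + 1) * S) := by
    refine le_of_mul_le_mul_right ?_ hE0
    have : 0 ≤ (n + 1) * S * E ^ (n + 1) := by positivity
    nlinarith
  rw [Real.exp_neg, ← div_eq_mul_inv, div_le_iff₀ (Real.exp_pos _)] at key2
  linarith

/-- Lower bound for the fundamental polynomials at the special point. -/
theorem exists_le_norm_eval_basis :
    ∃ κ : ℝ, 0 < κ ∧ ∀ (n : ℕ) (k : Fin (n + 1)) (d₀ d : ℝ), 0 < d₀ → d₀ ≤ d → d ≤ 1 / 4 →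
      (n + 1) * d₀ = π / 2 → 1 / 4 ≤ |Real.cos ((n + 1) * midAngle d₀)| →
      theta n k = outerAngle d →
      κ ≤ ‖(Lagrange.basis Finset.univ (fun j => (fejerPoint n j : ℂ)) k).eval
        (psi0 (exp (outerAngle d₀ * I)))‖ *
          ((n + 1) * d * |Real.sin ((n + 1) * midAngle d)|) := by
  refine ⟨Real.exp (-1000) / 120 / (300 * Real.exp 1000 * 54), by positivity, ?_⟩
  intro n k d₀ d hd0 hdd hd1 hn hcos hk
  have h1 := prod_norm_sub_ge hd0.le (hdd.trans hd1) hn hcos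
  have h2 := prod_erase_norm_sub_le (hd0.le.trans hdd) hd1 hk
  have h3 := norm_eval_basis_mul (fun j => (fejerPoint n j : ℂ))
    (Subtype.val_injective.comp (fejerPoint_injective n)) k (psi0 (exp (outerAngle d₀ * I)))
  change _ * (‖psi0 (exp (outerAngle d₀ * I)) - psi0 (node n k)‖ *
    ∏ j ∈ Finset.univ.erase k, ‖psi0 (node n k) - psi0 (node n j)‖) =
    ∏ j, ‖psi0 (exp (outerAngle d₀ * I)) - psi0 (node n j)‖ at h3
  rw [← h3] at h1
  have h4 : ‖psi0 (exp (outerAngle d₀ * I)) - psi0 (node n k)‖ ≤ 54 * d ^ 2 := by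
    rw [node, hk, psi0_outerAngle hd0.le (hdd.trans hd1), psi0_outerAngle (hd0.le.trans hdd) hd1,
      ← mul_sub, norm_mul, ← ofReal_sub, norm_real, Real.norm_eq_abs]
    have h5 := abs_radius_sub_le hd0.le hdd hd1
    have h6 : ‖(-1 + I : ℂ)‖ ≤ 2 := (norm_add_le _ _).trans (by simp; norm_num)
    nlinarith [norm_nonneg (-1 + I : ℂ), abs_nonneg (radius (outerAngle d₀) -
      radius (outerAngle d))]
  have hd : 0 < d := hd0.trans_le hdd
  set l := ‖(Lagrange.basis Finset.univ (fun j => (fejerPoint n j : ℂ)) k).eval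
        (psi0 (exp (outerAngle d₀ * I)))‖
  set A := ∏ j ∈ Finset.univ.erase k, ‖psi0 (node n k) - psi0 (node n j)‖
  have hA : 0 ≤ A := Finset.prod_nonneg fun _ _ => norm_nonneg _
  have hl : 0 ≤ l := norm_nonneg _
  set S := |Real.sin ((n + 1) * midAngle d)|
  rw [div_le_iff₀ (by positivity)]
  refine h1.trans ?_
  calc l * (‖psi0 (exp (outerAngle d₀ * I)) - psi0 (node n k)‖ * A)
      ≤ l * (54 * d ^ 2 * A) := by gcongr
    _ = l * (54 * d * (A * d)) := by ring
    _ ≤ l * (54 * d * (300 * Real.exp 1000 * ((n + 1) * S))) := by gcongr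
    _ = _ := by ring

/-! ### Parameters with prescribed angles, and terms at the special point -/

theorem exists_midAngle_eq {b : ℝ} (h0 : 0 ≤ b) (h1 : b ≤ 1 / 480) :
    ∃ d, 0 ≤ d ∧ d ≤ 1 / 4 ∧ midAngle d = 2 * π / 3 - b := by
  have h2 := sq_div_le_sub_midAngle (d := 1 / 4) (by norm_num) le_rfl
  obtain ⟨d, hd, hd'⟩ := intermediate_value_Icc' (by norm_num : (0 : ℝ) ≤ 1 / 4)
    continuousOn_midAngle (show 2 * π / 3 - b ∈ Set.Icc (midAngle (1 / 4)) (midAngle 0) by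
      rw [midAngle_zero]; constructor <;> linarith)
  exact ⟨d, hd.1, hd.2, hd'⟩

theorem exists_outerAngle_eq {t : ℝ} (h0 : 2 * π / 3 ≤ t) (h1 : t ≤ outerAngle (1 / 4)) :
    ∃ d, 0 ≤ d ∧ d ≤ 1 / 4 ∧ outerAngle d = t := by
  obtain ⟨d, hd, hd'⟩ := intermediate_value_Icc (by norm_num : (0 : ℝ) ≤ 1 / 4)
    (continuousOn_midAngle.add continuousOn_id)
    (show t ∈ Set.Icc (outerAngle 0) (outerAngle (1 / 4)) by
      rw [outerAngle_zero]; exact ⟨h0, h1⟩)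
  exact ⟨d, hd.1, hd.2, hd'⟩

theorem le_of_outerAngle_le {d e : ℝ} (he1 : d ≤ 1 / 4) (he0 : 0 ≤ e)
    (h : outerAngle d ≤ outerAngle e) : d ≤ e := by
  by_contra hlt
  push Not at hlt
  have := (outerAngle_sub_le he0 hlt.le he1).1
  linarith

/-- Near a solution of `sin (N * midAngle) = 0` that function is small. -/
theorem abs_sin_midAngle_le {N d e s : ℝ} (hN : 0 ≤ N) (h0 : 0 ≤ e) (hed : e ≤ d) (h1 : d ≤ 1 / 4)
    {q : ℤ} (hq : N * midAngle e = q * π) (hs : outerAngle d - outerAngle e ≤ s) :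
    |Real.sin (N * midAngle d)| ≤ N * s * d * (4 / 7) := by
  obtain ⟨h2, h3⟩ := midAngle_sub_le h0 hed h1
  have h4 := (outerAngle_sub_le h0 hed h1).1
  have h5 : N * midAngle d = q * π - N * (midAngle e - midAngle d) := by rw [← hq]; ring
  rw [h5, Real.sin_int_mul_pi_sub, abs_neg, abs_mul, abs_zpow, abs_neg, abs_one, one_zpow, one_mul]
  refine Real.abs_sin_le_abs.trans ?_
  rw [abs_of_nonneg (by positivity)]
  have h6 : midAngle e - midAngle d ≤ s * d * (4 / 7) := by
    have h7 : (d - e) ≤ s * (8 / 7) := by linarith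
    have h8 : (d - e) * (d + e) ≤ s * (8 / 7) * (2 * d) :=
      mul_le_mul h7 (by linarith) (by linarith) (by linarith)
    nlinarith
  calc _ ≤ N * (s * d * (4 / 7)) := by gcongr
    _ = _ := by ring

/-- `cos (2πN/3)` is `1` or `-1/2` for every integer `N`, and replacing `2π/3` by `midAngle d` moves
the argument by at most `N d² / 4 = π d / 8 ≤ 1/4`. -/
theorem abs_cos_special_ge {n : ℕ} (hn : 2 ≤ n) {d : ℝ} (h0 : 0 ≤ d) (h1 : d ≤ 1 / 4)
    (hd : (n + 1) * d = π / 2) : 1 / 4 ≤ |Real.cos ((n + 1) * midAngle d)| := by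
  obtain ⟨h2, h3⟩ := midAngle_sub_le le_rfl h0 h1
  rw [midAngle_zero] at h2 h3
  have hn' : (2 : ℝ) ≤ n := by exact_mod_cast hn
  have hpi := Real.pi_lt_d2
  have hpi0 := Real.pi_gt_three
  have h4 : (n + 1) * (2 * π / 3 - midAngle d) ≤ 1 / 4 := by
    have : (n + 1) * (2 * π / 3 - midAngle d) ≤ ((n + 1) * d) * d / 4 := by nlinarith
    rw [hd] at this
    have hd3 : d ≤ π / 6 := by nlinarith
    nlinarith
  have hc : 1 / 2 ≤ |Real.cos ((n + 1) * (2 * π / 3))| := by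
    have h3 : ∃ q : ℕ, n + 1 = 3 * q ∨ n + 1 = 3 * q + 1 ∨ n + 1 = 3 * q + 2 :=
      ⟨(n + 1) / 3, by omega⟩
    have hc4 : Real.cos (4 * π / 3) = -1 / 2 := by
      rw [show 4 * π / 3 = π / 3 + π by ring, Real.cos_add_pi, Real.cos_pi_div_three]; norm_num
    obtain ⟨q, hq | hq | hq⟩ := h3
    · rw [show ((n : ℝ) + 1) = 3 * q by exact_mod_cast hq,
        show 3 * (q : ℝ) * (2 * π / 3) = 0 + q * (2 * π) by ring, Real.cos_add_nat_mul_two_pi]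
      norm_num
    · rw [show ((n : ℝ) + 1) = 3 * q + 1 by exact_mod_cast hq,
        show (3 * (q : ℝ) + 1) * (2 * π / 3) = 2 * π / 3 + q * (2 * π) by ring,
        Real.cos_add_nat_mul_two_pi, cos_two_pi_div_three]
      norm_num [abs_of_neg]
    · rw [show ((n : ℝ) + 1) = 3 * q + 2 by exact_mod_cast hq,
        show (3 * (q : ℝ) + 2) * (2 * π / 3) = 4 * π / 3 + q * (2 * π) by ring,
        Real.cos_add_nat_mul_two_pi, hc4]
      norm_num [abs_of_neg]
  have h5 := Real.abs_cos_sub_cos_le ((n + 1) * (2 * π / 3)) ((n + 1) * midAngle d)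
  rw [← mul_sub, abs_of_nonneg (by positivity : 0 ≤ ((n : ℝ) + 1) * (2 * π / 3 - midAngle d))] at h5
  have h6 := abs_sub_abs_le_abs_sub (Real.cos ((n + 1) * (2 * π / 3)))
    (Real.cos ((n + 1) * midAngle d))
  linarith

/-- The norm of the fundamental polynomial at the special point. -/
noncomputable def specialBasis (n : ℕ) (k : Fin (n + 1)) : ℝ :=
  ‖(Lagrange.basis Finset.univ (fun j => (fejerPoint n j : ℂ)) k).eval
    (psi0 (exp (outerAngle (π / (2 * (n + 1))) * I)))‖

theorem sum_specialBasis_le {n : ℕ} (hn : 9 ≤ n) :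
    ∑ k, specialBasis n k ≤ lebesgueConstant (fejerPoint n) (fejerPoint_injective n) := by
  have hn' : (9 : ℝ) ≤ n := by exact_mod_cast hn
  have hmem := outerAngle_mem (d := π / (2 * (n + 1))) (by positivity) (by
    rw [div_le_iff₀ (by positivity)]; nlinarith [Real.pi_lt_d2])
  exact sum_norm_eval_basis_le_lebesgueConstant (fejerPoint n) (fejerPoint_injective n)
    ⟨_, psi0_exp_mem (by linarith [hmem.1, Real.pi_pos]) hmem.2⟩

theorem exists_le_specialBasis :
    ∃ κ : ℝ, 0 < κ ∧ ∀ (n : ℕ) (k : Fin (n + 1)) (d : ℝ), 9 ≤ n → π / (2 * (n + 1)) ≤ d →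
      d ≤ 1 / 4 → theta n k = outerAngle d →
      κ ≤ specialBasis n k * ((n + 1) * d * |Real.sin ((n + 1) * midAngle d)|) := by
  obtain ⟨κ, hκ, h⟩ := exists_le_norm_eval_basis
  refine ⟨κ, hκ, fun n k d hn hd hd1 hk => ?_⟩
  have hd0 : (0 : ℝ) < π / (2 * (n + 1)) := by positivity
  have hnd : (n + 1) * (π / (2 * (n + 1))) = π / 2 := by field_simp
  exact h n k _ d hd0 hd hd1 hnd
    (abs_cos_special_ge (by omega) hd0.le (hd.trans hd1) hnd) hk

/-! ### Linear growth along a subsequence -/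

/-- Linear growth along the integers `n` with `n + 1` an odd multiple of `3`. -/
theorem exists_linear_lower_bound :
    ∃ c : ℝ, 0 < c ∧ ∀ m : ℕ, c * (6 * (m + 10) + 2 : ℕ) ≤
      lebesgueConstant (fejerPoint (6 * (m + 10) + 2))
        (fejerPoint_injective (6 * (m + 10) + 2)) := by
  obtain ⟨κ, hκ, h⟩ := exists_le_specialBasis
  refine ⟨κ / 300, by positivity, fun m => ?_⟩
  obtain ⟨n, hn⟩ : ∃ n, n = 6 * (m + 10) + 2 := ⟨_, rfl⟩
  rw [← hn]
  have hpi := Real.pi_gt_three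
  have hpi2 := Real.pi_lt_d2
  have hN : (63 : ℝ) ≤ n + 1 := by exact_mod_cast (by omega : 63 ≤ n + 1)
  have hNpos : (0 : ℝ) < n + 1 := by linarith
  -- The index `(n + 1)/3 + 1`, the node right after the tip `2π/3`.
  let k : Fin (n + 1) := ⟨2 * (m + 10) + 2, by omega⟩
  have hk : theta n k = 2 * π / 3 + 2 * π / (n + 1) := by
    rw [theta, if_pos (by simp only [k]; omega), thetaUpper, if_pos (by rw [hn]; simp [parity_simps])]
    have : (n : ℝ) + 1 = 3 * (2 * (m + 10) + 1) := by rw [hn]; push_cast; ring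
    rw [this]; simp only [k]; push_cast; field_simp; ring
  have hsmall : 2 * π / (n + 1) ≤ 1 / 8 := by
    rw [div_le_iff₀ hNpos]; linarith
  have hsmall0 : 0 < 2 * π / (n + 1) := by positivity
  obtain ⟨d, hd0, hd1, hd⟩ := exists_outerAngle_eq (t := theta n k) (by rw [hk]; linarith)
    (by
      rw [hk]
      have := (outerAngle_bounds (d := 1 / 4) (by norm_num) le_rfl).1
      linarith)
  have hb := outerAngle_bounds hd0 hd1
  rw [hd, hk] at hb
  have hd2 : π / (2 * (n + 1)) ≤ d := by
    refine le_trans ?_ (by linarith [hb.2] : 2 * π / (n + 1) ≤ d)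
    rw [div_le_div_iff₀ (by positivity) hNpos]
    nlinarith
  have hmain := h n k d (by omega) hd2 hd1 hd.symm
  -- The tip itself is the exact coincidence: `N * midAngle 0 = 2πN/3` is a multiple of `π`.
  have hs := abs_sin_midAngle_le (N := n + 1) (e := 0) (q := 2 * (2 * (m + 10) + 1))
    (s := 2 * π / (n + 1)) hNpos.le le_rfl hd0 hd1
    (by rw [midAngle_zero, hn]; push_cast; ring) (by rw [hd, hk, outerAngle_zero]; linarith)
  rw [mul_div_cancel₀ _ hNpos.ne'] at hs
  have hdN : (n + 1) * d ≤ 8 := by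
    have : d ≤ 2 * π / (n + 1) * (8 / 7) := by linarith [hb.1]
    calc (n + 1) * d ≤ (n + 1) * (2 * π / (n + 1) * (8 / 7)) := by gcongr
      _ = 2 * π * (8 / 7) := by field_simp
      _ ≤ 8 := by linarith
  have hl : 0 ≤ specialBasis n k := norm_nonneg _
  have h1 : κ ≤ specialBasis n k * (8 * (4 * d)) := by
    refine hmain.trans ?_
    gcongr
    refine hs.trans ?_
    nlinarith
  have h2 : κ * (n + 1) ≤ specialBasis n k * 300 := by
    calc κ * (n + 1) ≤ specialBasis n k * (8 * (4 * d)) * (n + 1) := by gcongr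
      _ = specialBasis n k * (32 * ((n + 1) * d)) := by ring
      _ ≤ specialBasis n k * (32 * 8) := by gcongr
      _ ≤ _ := by gcongr; norm_num
  have h3 := (Finset.single_le_sum (fun k _ => norm_nonneg _) (Finset.mem_univ k)).trans
    (sum_specialBasis_le (n := n) (by omega))
  refine le_trans ?_ h3
  change _ ≤ specialBasis n k
  linarith

/-! ### The `log²` lower bound for all `n` -/

/-- A single term of the Lebesgue function, at a Fejér angle close to an angle where the other
preimage is a Fejér angle too. -/
theorem le_specialBasis_of_near {κ : ℝ} (hκ : 0 < κ)
    (h : ∀ (n : ℕ) (k : Fin (n + 1)) (d : ℝ), 9 ≤ n → π / (2 * (n + 1)) ≤ d →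
      d ≤ 1 / 4 → theta n k = outerAngle d →
      κ ≤ specialBasis n k * ((n + 1) * d * |Real.sin ((n + 1) * midAngle d)|))
    {n : ℕ} (hn9 : 9 ≤ n) {k : Fin (n + 1)} {N e d m i f : ℝ} (hN : N = n + 1)
    (hm1 : 1 ≤ m) (hi1 : 1 ≤ i) (hf0 : 0 ≤ f) (he0 : 0 ≤ e) (hed : e ≤ d) (hd1 : d ≤ 1 / 4)
    {q : ℤ} (hq : N * midAngle e = q * π) (hlo : 4 * (π * (m + f) / N) ≤ e ^ 2)
    (hup : d ^ 2 ≤ 90 * π * m / N) (hk : theta n k = outerAngle d)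
    (hs : outerAngle d - outerAngle e ≤ (i + 1) * (2 * π / N)) :
    κ / 8000 * (m⁻¹ * i⁻¹) ≤ specialBasis n k := by
  have hpi := Real.pi_gt_three
  have hpi2 := Real.pi_lt_d2
  have hN1 : 1 ≤ N := by rw [hN]; linarith [(Nat.cast_nonneg n : (0 : ℝ) ≤ n)]
  have hNpos : 0 < N := by linarith
  have hd0 : 0 ≤ d := he0.trans hed
  have hdlow : π / (2 * (n + 1)) ≤ d := by
    refine le_trans ?_ hed
    refine le_of_pow_le_pow_left₀ (n := 2) two_ne_zero he0 (le_trans ?_ hlo)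
    rw [← hN, div_pow, mul_div_assoc', div_le_div_iff₀ (by positivity) hNpos]
    have h1 : π * N ≤ π * (m + f) * N * N := by
      have : 1 ≤ (m + f) * N := by nlinarith
      calc π * N = π * N * 1 := (mul_one _).symm
        _ ≤ π * N * ((m + f) * N) := by gcongr
        _ = _ := by ring
    have h2 : π ^ 2 * N ≤ 4 * (π * N) := by
      rw [sq, mul_assoc]; gcongr; linarith
    have h3 : 0 < π * N := by positivity
    rw [show 4 * (π * (m + f)) * (2 * N) ^ 2 = 16 * (π * (m + f) * N * N) by ring]
    linarith
  have hmain := h n k d hn9 hdlow hd1 hk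
  have hsin := abs_sin_midAngle_le hNpos.le he0 hed hd1 hq hs
  have hs2 : N * ((i + 1) * (2 * π / N)) * d * (4 / 7) ≤ 8 * i * d := by
    have : N * ((i + 1) * (2 * π / N)) * d * (4 / 7) = 8 / 7 * π * (i + 1) * d := by
      field_simp; ring
    rw [this]
    refine mul_le_mul_of_nonneg_right ?_ hd0
    nlinarith
  rw [← hN] at hmain
  have hl : 0 ≤ specialBasis n k := norm_nonneg _
  have hfin : κ ≤ specialBasis n k * (8000 * m * i) := by
    refine hmain.trans (mul_le_mul_of_nonneg_left ?_ hl)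
    calc N * d * |Real.sin (N * midAngle d)| ≤ N * d * (8 * i * d) := by
          gcongr; exact hsin.trans hs2
      _ = 8 * i * (N * d ^ 2) := by ring
      _ ≤ 8 * i * (N * (90 * π * m / N)) := by gcongr
      _ = 720 * π * (m * i) := by field_simp; ring
      _ ≤ 8000 * (m * i) := by gcongr; linarith
      _ = _ := by ring
  have hmi : (0 : ℝ) < 8000 * m * i := by positivity
  rw [← div_le_iff₀ hmi] at hfin
  refine le_trans (le_of_eq ?_) hfin
  field_simp

set_option maxHeartbeats 1000000 in
/-- Summing the Lebesgue function over the near-coincidences of images around the tip. -/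
theorem mul_harmonic_le_lebesgueConstant {κ : ℝ} (hκ : 0 < κ)
    (h : ∀ (n : ℕ) (k : Fin (n + 1)) (d : ℝ), 9 ≤ n → π / (2 * (n + 1)) ≤ d →
      d ≤ 1 / 4 → theta n k = outerAngle d →
      κ ≤ specialBasis n k * ((n + 1) * d * |Real.sin ((n + 1) * midAngle d)|))
    {n p : ℕ} (hp : 1 ≤ p) (hpn : 10000 * p ^ 4 ≤ n + 1) :
    κ / 8000 * ((∑ m ∈ Finset.Icc 1 (p ^ 2), (m : ℝ)⁻¹) * ∑ i ∈ Finset.Icc 1 p, (i : ℝ)⁻¹) ≤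
      lebesgueConstant (fejerPoint n) (fejerPoint_injective n) := by
  have hpi := Real.pi_gt_three
  have hpi2 := Real.pi_lt_d2
  have hp4 : 1 ≤ p ^ 4 := Nat.one_le_pow _ _ hp
  have hn9 : 9 ≤ n := by omega
  have hp1 : (1 : ℝ) ≤ p := by exact_mod_cast hp
  have hpN : 10000 * (p : ℝ) ^ 4 ≤ n + 1 := by exact_mod_cast hpn
  have hp4' : (1 : ℝ) ≤ (p : ℝ) ^ 4 := one_le_pow₀ hp1
  have hp2' : (1 : ℝ) ≤ (p : ℝ) ^ 2 := one_le_pow₀ hp1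
  obtain ⟨N, hN⟩ : ∃ N : ℝ, N = n + 1 := ⟨_, rfl⟩
  rw [← hN] at hpN
  have hN0 : 10000 ≤ N := by linarith
  have hNpos : 0 < N := by linarith
  -- With `f` the fractional part of `2N/3`, the equation `N β = (Q - m) π` reads `β = 2π/3 - π (m +
  -- f) / N`.
  obtain ⟨Q, f, hf, hf0, hf1⟩ : ∃ (Q : ℤ) (f : ℝ), f = 2 * N / 3 - Q ∧ 0 ≤ f ∧ f ≤ 1 :=
    ⟨⌊2 * N / 3⌋, _, rfl, by linarith [Int.floor_le (2 * N / 3)],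
      by linarith [Int.lt_floor_add_one (2 * N / 3)]⟩
  have hsmall : ∀ m : ℕ, m ≤ p ^ 2 + 1 → π * (m + f) / N ≤ 3 * π * p ^ 2 / N := by
    intro m hm
    have hm' : (m : ℝ) ≤ p ^ 2 + 1 := by exact_mod_cast hm
    gcongr ?_ / N
    nlinarith
  have hp2N : (p : ℝ) ^ 2 * 10000 * p ^ 2 ≤ N := by
    rw [show (p : ℝ) ^ 2 * 10000 * p ^ 2 = 10000 * (p : ℝ) ^ 4 by ring]
    exact hpN
  have hb : ∀ m : ℕ, ∃ d, m ≤ p ^ 2 + 1 →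
      0 ≤ d ∧ d ≤ 1 / 4 ∧ midAngle d = 2 * π / 3 - π * (m + f) / N := by
    intro m
    by_cases hm : m ≤ p ^ 2 + 1
    · obtain ⟨d, hd⟩ := exists_midAngle_eq (b := π * (m + f) / N) (by positivity) (by
        refine (hsmall m hm).trans ?_
        rw [div_le_iff₀ hNpos]
        nlinarith)
      exact ⟨d, fun _ => hd⟩
    · exact ⟨0, fun h => absurd h hm⟩
  choose D hD using hb
  have hDup : ∀ m : ℕ, m ≤ p ^ 2 + 1 → D m ^ 2 ≤ 30 * (π * (m + f) / N) := by
    intro m hm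
    obtain ⟨h0, h1, h2⟩ := hD m hm
    have := sq_div_le_sub_midAngle h0 h1
    rw [h2] at this
    linarith
  have hDlo : ∀ m : ℕ, m ≤ p ^ 2 + 1 → 4 * (π * (m + f) / N) ≤ D m ^ 2 := by
    intro m hm
    obtain ⟨h0, h1, h2⟩ := hD m hm
    have := (midAngle_sub_le le_rfl h0 h1).2
    rw [midAngle_zero, h2] at this
    linarith
  have hDmono : ∀ m m' : ℕ, m ≤ m' → m' ≤ p ^ 2 + 1 → D m ≤ D m' := by
    intro m m' hmm hm'
    obtain ⟨h0, h1, h2⟩ := hD m (hmm.trans hm')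
    obtain ⟨h0', h1', h2'⟩ := hD m' hm'
    by_contra hlt
    push Not at hlt
    have h3 := (midAngle_sub_le h0' hlt.le h1).1
    rw [h2, h2'] at h3
    have h4 : π * (m + f) / N ≤ π * (m' + f) / N := by gcongr
    have h5 : π * (m + f) / N = π * (m' + f) / N := by linarith
    have h8 : midCos (D m) = midCos (D m') := by
      rw [← cos_midAngle h0 h1, ← cos_midAngle h0' h1', h2, h2', h5]
    have h9 := (midCos_mono h0' hlt.le h1).1
    have h10 : Real.cos (D m) < Real.cos (D m') :=
      Real.cos_lt_cos_of_nonneg_of_le_pi h0' (by linarith) hlt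
    linarith
  obtain ⟨η, hη⟩ : ∃ η : ℝ, η = 2 * π / N := ⟨_, rfl⟩
  have hη0 : 0 < η := by rw [hη]; positivity
  -- consecutive solutions are separated by many Fejér angles
  have hstep : ∀ m : ℕ, m ≤ p ^ 2 →
      outerAngle (D m) + (p + 1) * η ≤ outerAngle (D (m + 1)) := by
    intro m hm
    obtain ⟨h0, h1, h2⟩ := hD m (by omega)
    obtain ⟨h0', h1', h2'⟩ := hD (m + 1) (by omega)
    have hmm := hDmono m (m + 1) (by omega) (by omega)
    have h3 := (midAngle_sub_le h0 hmm h1').2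
    rw [h2, h2'] at h3
    have h4 : π * ((m + 1 : ℕ) + f) / N - π * (m + f) / N = η / 2 := by
      rw [hη]; push_cast; field_simp; ring
    have h5 : η ≤ (D (m + 1) - D m) * D (m + 1) := by
      have : η / 2 ≤ (D (m + 1) ^ 2 - D m ^ 2) / 4 := by linarith
      nlinarith
    -- `D²` is `O(p²/N)`, so this is where `p⁴` must be small against `N`. The constant `7/8`
    -- matches the lower Lipschitz bound of `outerAngle`.
    have h6 : (p + 1) * D (m + 1) ≤ 7 / 8 := by
      refine le_of_pow_le_pow_left₀ (n := 2) two_ne_zero (by norm_num) ?_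
      have h7 := (hDup (m + 1) (by omega)).trans
        (mul_le_mul_of_nonneg_left (hsmall (m + 1) (by omega)) (by norm_num))
      have h8 : (p + 1 : ℝ) ^ 2 ≤ 4 * p ^ 2 := by nlinarith
      rw [mul_pow]
      calc _ ≤ 4 * (p : ℝ) ^ 2 * (30 * (3 * π * p ^ 2 / N)) :=
            mul_le_mul h8 h7 (sq_nonneg _) (by positivity)
        _ = 360 * π * (p ^ 2 * p ^ 2) / N := by ring
        _ ≤ _ := by
          rw [div_le_iff₀ hNpos]
          nlinarith
    have h7 := (outerAngle_sub_le h0 hmm h1').1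
    have h8 : (p + 1) * η ≤ (D (m + 1) - D m) * (7 / 8) := by
      calc (p + 1) * η ≤ (p + 1) * ((D (m + 1) - D m) * D (m + 1)) := by gcongr
        _ = (D (m + 1) - D m) * ((p + 1) * D (m + 1)) := by ring
        _ ≤ _ := by
          have : 0 ≤ D (m + 1) - D m := by linarith
          gcongr
    linarith
  obtain ⟨o, ho⟩ : ∃ o : ℝ, o = if Even n then 0 else 1 / 2 := ⟨_, rfl⟩
  have ho0 : 0 ≤ o ∧ o ≤ 1 / 2 := by rw [ho]; split_ifs <;> norm_num
  have hgrid : ∀ j : ℕ, thetaUpper n j = η * (o + j) := by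
    intro j; rw [thetaUpper_eq, ← ho, ← hN, ← hη]
  -- the first Fejér angle after the `m`-th solution
  have hK : ∀ m : ℕ, ∃ K : ℕ, m ≤ p ^ 2 + 1 → outerAngle (D m) ≤ η * (o + K) ∧
      η * (o + K) ≤ outerAngle (D m) + η := by
    intro m
    refine ⟨⌈outerAngle (D m) / η - o⌉₊, fun hm => ?_⟩
    obtain ⟨h0, h1, -⟩ := hD m hm
    have h2 := (outerAngle_bounds h0 h1).1
    have h3 : η ≤ 1 := by rw [hη, div_le_one hNpos]; linarith
    have h4 : 0 ≤ outerAngle (D m) / η - o := by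
      rw [sub_nonneg, le_div_iff₀ hη0]; nlinarith
    have h5 := Nat.le_ceil (outerAngle (D m) / η - o)
    have h6 := (Nat.ceil_lt_add_one h4).le
    have h7 : η * (outerAngle (D m) / η) = outerAngle (D m) := by field_simp
    obtain ⟨r, hr⟩ : ∃ r, r = outerAngle (D m) / η := ⟨_, rfl⟩
    rw [← hr] at h5 h6 h7 ⊢
    rw [← h7]
    constructor
    · exact mul_le_mul_of_nonneg_left (by linarith) hη0.le
    · calc η * (o + ⌈r - o⌉₊) ≤ η * (r + 1) := mul_le_mul_of_nonneg_left (by linarith) hη0.le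
        _ = _ := by rw [mul_add, mul_one]
  choose K hK using hK
  have hbetween : ∀ m i : ℕ, m ≤ p ^ 2 → 1 ≤ i → i ≤ p →
      outerAngle (D m) ≤ thetaUpper n (K m + i) ∧
      thetaUpper n (K m + i) ≤ outerAngle (D m) + (i + 1) * η ∧
      thetaUpper n (K m + i) ≤ outerAngle (D (m + 1)) := by
    intro m i hm hi hip
    obtain ⟨h1, h2⟩ := hK m (by omega)
    have hs := hstep m hm
    have e : thetaUpper n (K m + i) = η * (o + K m) + i * η := by
      rw [hgrid]; push_cast; ring
    have hip' : (i : ℝ) * η ≤ p * η := by gcongr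
    have hi0 : 0 ≤ (i : ℝ) * η := by positivity
    rw [e]
    refine ⟨by linarith, by linarith, by linarith⟩
  have hindex : ∀ m i : ℕ, m ≤ p ^ 2 → 1 ≤ i → i ≤ p → K m + i ≤ n / 2 := by
    intro m i hm hi hip
    obtain ⟨-, -, h3⟩ := hbetween m i hm hi hip
    obtain ⟨h0', h1', -⟩ := hD (m + 1) (by omega)
    have h4 := h3.trans_lt (outerAngle_mem h0' h1').2
    rw [hgrid, hη, div_mul_eq_mul_div, div_lt_iff₀ hNpos] at h4
    have h5 : 2 * (o + (K m + i : ℕ)) < n + 1 := by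
      rw [← hN]
      refine lt_of_mul_lt_mul_left ?_ Real.pi_pos.le
      linarith
    rcases Nat.even_or_odd' n with ⟨c, hc | hc⟩
    · rw [ho, if_pos (by simp [hc])] at h5
      have h6 : 2 * (K m + i) < n + 1 := by exact_mod_cast (by linarith :
        (2 : ℝ) * (K m + i : ℕ) < n + 1)
      omega
    · rw [ho, if_neg (by simp [hc])] at h5
      have h6 : 2 * (K m + i) < n := by exact_mod_cast (by linarith :
        (2 : ℝ) * (K m + i : ℕ) < n)
      omega
  let S : Finset (ℕ × ℕ) := Finset.Icc 1 (p ^ 2) ×ˢ Finset.Icc 1 p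
  -- The reduction modulo `n + 1` has no effect on `S`, where the index is at most `n / 2`. Starting
  -- at `i = 1` keeps consecutive blocks disjoint.
  let g : ℕ × ℕ → Fin (n + 1) := fun x => Fin.ofNat (n + 1) (K x.1 + x.2)
  have hS : ∀ x ∈ S, 1 ≤ x.1 ∧ x.1 ≤ p ^ 2 ∧ 1 ≤ x.2 ∧ x.2 ≤ p := by
    intro x hx
    obtain ⟨h1, h2⟩ := Finset.mem_product.mp hx
    exact ⟨(Finset.mem_Icc.mp h1).1, (Finset.mem_Icc.mp h1).2, (Finset.mem_Icc.mp h2).1,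
      (Finset.mem_Icc.mp h2).2⟩
  have hgval : ∀ x ∈ S, (g x : ℕ) = K x.1 + x.2 := by
    intro x hx
    obtain ⟨h1, h2, h3, h4⟩ := hS x hx
    have := hindex x.1 x.2 h2 h3 h4
    change (K x.1 + x.2) % (n + 1) = _
    exact Nat.mod_eq_of_lt (by omega)
  have hlt : ∀ x ∈ S, ∀ y ∈ S, x.1 < y.1 → K x.1 + x.2 < K y.1 + y.2 := by
    intro x hx y hy hxy
    obtain ⟨h1, h2, h3, h4⟩ := hS x hx
    obtain ⟨h1', h2', h3', h4'⟩ := hS y hy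
    have a := (hbetween x.1 x.2 h2 h3 h4).2.2
    have hm := hDmono (x.1 + 1) y.1 hxy (by omega)
    obtain ⟨e0, e1, -⟩ := hD (x.1 + 1) (by omega)
    obtain ⟨e0', e1', -⟩ := hD y.1 (by omega)
    have b := (outerAngle_sub_le e0 hm e1').1
    have c := (hK y.1 (by omega)).1
    rw [hgrid] at a
    have d : η * (o + (K x.1 + x.2 : ℕ)) ≤ η * (o + K y.1) := by linarith
    have e := le_of_mul_le_mul_left d hη0
    have f : K x.1 + x.2 ≤ K y.1 := by exact_mod_cast (by linarith :
      ((K x.1 + x.2 : ℕ) : ℝ) ≤ K y.1)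
    omega
  have hinj : Set.InjOn g S := by
    intro x hx y hy hxy
    have h1 : K x.1 + x.2 = K y.1 + y.2 := by
      rw [← hgval x hx, ← hgval y hy, hxy]
    rcases lt_trichotomy x.1 y.1 with h2 | h2 | h2
    · have := hlt x hx y hy h2; omega
    · refine Prod.ext h2 ?_
      rw [h2] at h1; omega
    · have := hlt y hy x hx h2; omega
  have hterm : ∀ x ∈ S, κ / 8000 * ((x.1 : ℝ)⁻¹ * (x.2 : ℝ)⁻¹) ≤ specialBasis n (g x) := by
    intro x hx
    obtain ⟨hm1, hm2, hi1, hi2⟩ := hS x hx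
    obtain ⟨m, i⟩ := x
    simp only at hm1 hm2 hi1 hi2 ⊢
    have hm1' : (1 : ℝ) ≤ m := by exact_mod_cast hm1
    have hi1' : (1 : ℝ) ≤ i := by exact_mod_cast hi1
    obtain ⟨b1, b2, b3⟩ := hbetween m i hm2 hi1 hi2
    have hθ : theta n (g (m, i)) = thetaUpper n (K m + i) := by
      rw [hgval _ hx, theta, if_pos (hindex m i hm2 hi1 hi2)]
    obtain ⟨e0, e1, e2⟩ := hD m (by omega)
    obtain ⟨e0', e1', -⟩ := hD (m + 1) (by omega)
    obtain ⟨d, hd0, hd1, hd⟩ := exists_outerAngle_eq (t := thetaUpper n (K m + i))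
      (by linarith [(outerAngle_bounds e0 e1).1])
      (by linarith [(outerAngle_sub_le e0' e1' le_rfl).1])
    have hed : D m ≤ d := le_of_outerAngle_le e1 hd0 (by rw [hd]; exact b1)
    have hdD : d ≤ D (m + 1) := le_of_outerAngle_le hd1 e0' (by rw [hd]; exact b3)
    have hdsq : d ^ 2 ≤ 90 * π * m / N := by
      -- The factor `90` is `30 * 3`, from `m + 1 + f ≤ 3 m`.
      refine (pow_le_pow_left₀ hd0 hdD 2).trans ((hDup (m + 1) (by omega)).trans ?_)
      rw [mul_div_assoc', div_le_div_iff_of_pos_right hNpos]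
      push_cast
      nlinarith
    refine le_specialBasis_of_near hκ h hn9 (e := D m) (d := d) (f := f)
      (q := Q - m) hN hm1' hi1' hf0 e0 hed hd1 ?_ (hDlo m (by omega)) hdsq
      (by rw [hθ, hd]) (by rw [hd, ← hη]; linarith)
    rw [e2]; push_cast
    field_simp
    linear_combination -3 * hf
  calc κ / 8000 * ((∑ m ∈ Finset.Icc 1 (p ^ 2), (m : ℝ)⁻¹) * ∑ i ∈ Finset.Icc 1 p, (i : ℝ)⁻¹)
      = ∑ x ∈ S, κ / 8000 * ((x.1 : ℝ)⁻¹ * (x.2 : ℝ)⁻¹) := by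
        rw [← Finset.mul_sum, Finset.sum_product, Finset.sum_mul_sum]
    _ ≤ ∑ x ∈ S, specialBasis n (g x) := Finset.sum_le_sum hterm
    _ = ∑ k ∈ S.image g, specialBasis n k := (Finset.sum_image hinj).symm
    _ ≤ ∑ k, specialBasis n k := Finset.sum_le_sum_of_subset_of_nonneg (Finset.subset_univ _)
        fun _ _ _ => norm_nonneg _
    _ ≤ _ := sum_specialBasis_le hn9

theorem log_add_one_le_sum_inv (p : ℕ) :
    Real.log (p + 1) ≤ ∑ i ∈ Finset.Icc 1 p, (i : ℝ)⁻¹ := by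
  have := log_add_one_le_harmonic p
  rw [harmonic_eq_sum_Icc] at this
  push_cast at this
  exact this

theorem exists_log_sq_lower_bound :
    ∃ c : ℝ, 0 < c ∧ ∀ n : ℕ, 1 ≤ n →
      c * Real.log n ^ 2 ≤ lebesgueConstant (fejerPoint n) (fejerPoint_injective n) := by
  obtain ⟨κ, hκ, h⟩ := exists_le_specialBasis
  refine ⟨min (κ / 8000 / 324) (1 / 324), by positivity, fun n hn => ?_⟩
  have hn' : (1 : ℝ) ≤ n := by exact_mod_cast hn
  have hlog0 : 0 ≤ Real.log n := Real.log_nonneg hn'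
  -- The least such `p` is the largest with `10000 p⁴ ≤ n + 1`. If it is `0`, then `log n ≤ 18` and
  -- the trivial bound `1` suffices, whence `324 = 18²`; otherwise `log n ≤ 18 log (p + 1)`.
  have hex : ∃ p : ℕ, n + 1 < 10000 * (p + 1) ^ 4 := ⟨n, by
    have := Nat.le_self_pow (n := 4) (by norm_num) (n + 1); omega⟩
  classical
  set p := Nat.find hex with hpdef
  have hp := Nat.find_spec hex
  rw [← hpdef] at hp
  have hlog2 : Real.log 10000 ≤ 14 * Real.log 2 := by
    rw [show (14 : ℝ) * Real.log 2 = Real.log (2 ^ 14) by rw [Real.log_pow]; norm_num]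
    exact Real.log_le_log (by norm_num) (by norm_num)
  have hlogn : Real.log n ≤ 14 * Real.log 2 + 4 * Real.log (p + 1) := by
    have h1 : (n : ℝ) ≤ 10000 * (p + 1) ^ 4 := by
      have : n ≤ 10000 * (p + 1) ^ 4 := by omega
      exact_mod_cast this
    have h2 := Real.log_le_log (by linarith) h1
    rw [Real.log_mul (by norm_num) (by positivity), Real.log_pow] at h2
    push_cast at h2
    linarith
  rcases Nat.eq_zero_or_pos p with h0 | hpos
  · rw [h0] at hlogn
    simp at hlogn
    have hle : Real.log n ≤ 18 := by linarith [Real.log_two_lt_d9]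
    refine le_trans ?_ (one_le_lebesgueConstant _ _)
    calc min (κ / 8000 / 324) (1 / 324) * Real.log n ^ 2 ≤ 1 / 324 * 18 ^ 2 := by
          gcongr; exact min_le_right _ _
      _ = 1 := by norm_num
  · have hpn : 10000 * p ^ 4 ≤ n + 1 := by
      have := Nat.find_min hex (m := p - 1) (by omega)
      rw [Nat.sub_add_cancel hpos] at this
      omega
    have hp1 : (1 : ℝ) ≤ p := by exact_mod_cast hpos
    have hlp : Real.log 2 ≤ Real.log (p + 1) := Real.log_le_log (by norm_num) (by linarith)
    have hlp0 : 0 ≤ Real.log (p + 1) := (Real.log_nonneg (by norm_num)).trans hlp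
    have hle : Real.log n ≤ 18 * Real.log (p + 1) := by linarith
    refine le_trans ?_ (mul_harmonic_le_lebesgueConstant hκ h hpos hpn)
    have a1 := log_add_one_le_sum_inv p
    have a2 : Real.log (p + 1) ≤ ∑ m ∈ Finset.Icc 1 (p ^ 2), (m : ℝ)⁻¹ := by
      refine le_trans ?_ (log_add_one_le_sum_inv (p ^ 2))
      refine Real.log_le_log (by positivity) ?_
      push_cast
      nlinarith
    calc min (κ / 8000 / 324) (1 / 324) * Real.log n ^ 2
        ≤ κ / 8000 / 324 * (18 * Real.log (p + 1)) ^ 2 := by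
          gcongr; exact min_le_left _ _
      _ = κ / 8000 * (Real.log (p + 1) * Real.log (p + 1)) := by ring
      _ ≤ _ := by gcongr

/-! ### Conclusion -/

theorem limsup_eq_top_of_linear {u : ℕ → ℝ} {φ : ℕ → ℕ} (hφ : StrictMono φ) {c : ℝ} (hc : 0 < c)
    (h : ∀ m, c * φ m ≤ u (φ m)) :
    Filter.limsup (fun n : ℕ => ((u n / Real.log n ^ 2 : ℝ) : EReal)) Filter.atTop = ⊤ := by
  rw [EReal.eq_top_iff_forall_lt]
  intro y
  refine lt_of_lt_of_le (b := ((|y| + 1 : ℝ) : EReal)) ?_ ?_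
  · exact_mod_cast (by linarith [le_abs_self y] : y < |y| + 1)
  refine Filter.le_limsup_of_frequently_le ?_ (by isBoundedDefault)
  have hB : 0 < |y| + 1 := by positivity
  -- `log² n = o(n)`, with the constant chosen so that the quotient exceeds `|y| + 1` along the
  -- subsequence.
  have ho := (Real.isLittleO_pow_log_id_atTop (n := 2)).bound (c := c / (|y| + 1)) (by positivity)
  have ho' := (hφ.tendsto_atTop.eventually (tendsto_natCast_atTop_atTop.eventually ho)).and
    (hφ.tendsto_atTop.eventually_ge_atTop 2)
  refine hφ.tendsto_atTop.frequently (Filter.Eventually.frequently ?_)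
  filter_upwards [ho'] with m ⟨hm, hm2⟩
  have hm2' : (2 : ℝ) ≤ φ m := by exact_mod_cast hm2
  have hlog : 0 < Real.log (φ m) := Real.log_pos (by linarith)
  rw [Real.norm_of_nonneg (by positivity), id, Real.norm_of_nonneg (by positivity),
    div_mul_eq_mul_div, le_div_iff₀ hB] at hm
  have : |y| + 1 ≤ u (φ m) / Real.log (φ m) ^ 2 := by
    rw [le_div_iff₀ (by positivity)]
    linarith [h m]
  exact_mod_cast this

end FejerLebesgue

theorem theorem1 :
    (∃ c₁ : ℝ, 0 < c₁ ∧ ∀ n : ℕ, 1 ≤ n →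
      c₁ * Real.log n ^ 2 ≤ FejerLebesgue.lebesgueConstant (FejerLebesgue.fejerPoint n) (FejerLebesgue.fejerPoint_injective n)) ∧
    Filter.limsup (fun n : ℕ =>
      ((FejerLebesgue.lebesgueConstant (FejerLebesgue.fejerPoint n) (FejerLebesgue.fejerPoint_injective n) / Real.log n ^ 2 : ℝ) : EReal))
      Filter.atTop = ⊤ ∧
    (∃ c₂ : ℝ, 0 < c₂ ∧ ∃ φ : ℕ → ℕ, StrictMono φ ∧ ∀ m : ℕ,
      c₂ * (φ m : ℝ) ^ (1 / 3 : ℝ) ≤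
        FejerLebesgue.lebesgueConstant (FejerLebesgue.fejerPoint (φ m)) (FejerLebesgue.fejerPoint_injective (φ m))) := by
  -- The linear bound serves both the second and the third claim, the latter through `n^{1/3} ≤ n`.
  obtain ⟨c, hc, h⟩ := FejerLebesgue.exists_linear_lower_bound
  have hφ : StrictMono fun m : ℕ => 6 * (m + 10) + 2 := fun a b hab => by
    simp only; omega
  refine ⟨FejerLebesgue.exists_log_sq_lower_bound,
    FejerLebesgue.limsup_eq_top_of_linear
      (u := fun n => FejerLebesgue.lebesgueConstant (FejerLebesgue.fejerPoint n)
        (FejerLebesgue.fejerPoint_injective n)) hφ hc h,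
    c, hc, _, hφ, fun m => le_trans ?_ (h m)⟩
  have h1 : (1 : ℝ) ≤ ((6 * (m + 10) + 2 : ℕ) : ℝ) := by
    exact_mod_cast (by omega : 1 ≤ 6 * (m + 10) + 2)
  have h2 := Real.rpow_le_rpow_of_exponent_le h1 (by norm_num : (1 / 3 : ℝ) ≤ 1)
  rw [Real.rpow_one] at h2
  exact mul_le_mul_of_nonneg_left h2 hc.le
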